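/- **Setting.** A sequential specification $Spec$ is the set of finite traces of a labelled transition system (LTS) $S$ whose labels are operations $m(a)\Rightarrow b$ (method, argument, return value). $Spec$ is deterministic (resp. non-blocking) if from each state of $S$, for each $m$ and $a$, there is at most (resp. at least) one transition with a label of the form $m(a)\Rightarrow\cdot$. A concurrent object $\mathcal O$ has a shared memory, local states of processes, an entry state for each process and invocation $(m,a)$, arbitrary (possibly nondeterministic) atomic commands that act on the local state of the executing process and the shared memory, and local states in which a value may be returned. $[\![\mathcal O,n]\!]$ is the LTS of $n$ processes, each of which repeatedly calls an arbitrary method of $\mathcal O$ with an arbitrary argument; its labels are call actions $call(P_i,m,a)$, return actions $return(P_i,m,b)$ and internal actions. A history is a finite sequence of call and return actions in which, for each process, calls and matching returns alternate, starting with a call. A sequential history $s$ is a linearization of a history $h$ w.r.t. $Spec$ if $s$ is the sequence of call/return pairs, by arbitrary processes, of an operation sequence in $Spec$, and $h$ can be extended by return actions to a history $h'$ such that, with $complete(h')$ obtained from $h'$ by deleting the pending calls, $complete(h')$ and $s$ have the same subhistory for each process, and whenever $o_1$ returns before $o_2$ is called in $complete(h')$, the same holds in $s$. $\mathcal O$ is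 linearizable w.r.t. $Spec$ for $n$ processes if for every finite trace of $[\![\mathcal O,n]\!]$ its projection to call and return actions has a linearization. $A_1\preceq_{(c,r)}A_2$ means that there is a relation $R$ between the states of the LTSs $A_1$ and $A_2$ that contains the pair of initial states and is such that, if $(c_1,c_2)\in R$ and $c_1\xrightarrow{\alpha}c_1'$, then $c_2\xrightarrow{l}c_2'$ for some finite sequence $l$ of labels and some $c_2'$ with $(c_1',c_2')\in R$, where $\alpha$ and $l$ have the same projection to call and return actions. **The object $\mathcal U_{Spec}$.** It has one method $apply$; a call $apply(m,a)$ returning $b$ is regarded as the operation $m(a)\Rightarrow b$. Its shared memory consists of a generator of unique operation identities, a history recorder (a sequence of call and return actions tagged with operation identities, initially empty), nodes with fields $m,a,oid,hist,lin,decideNext,seq,next$ that form a linked list through $next$, and arrays $head[]$, $announce[]$ indexed by the processes $0,\dots,n-1$. In a new node $seq=0$ and $hist,lin,next$ are null; $decideNext$ is a consensus object: the first proposal is stored, and every call of $decide$ returns it. Initially the list consists of a sentinel node (the tail) with $seq=1$, to which all entries of $head$ and $announce$ refer. Process $pid$ executes $apply(m,a)$ as follows, each line being one atomic command: 1. $oid:=genID()$,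 a new identity; 2. append $call(pid,m,a)$, tagged $oid$, to the recorder; 3. $announce[pid]:=\mathbf{new}\ Node(m,a,oid)$; 4. $head[pid]:=$ a node with maximal $seq$ among the entries of $head$; 5. while $announce[pid].seq=0$: - $before:=head[pid]$; - $help:=announce[(before.seq+1)\bmod n]$; - test whether $help.seq=0$; - $prefer:=help$ if it is, and otherwise $prefer:=announce[pid]$; - $after:=before.decideNext.decide(prefer)$; - $h_1:=$ the content of the recorder; - $cas(after.hist,null,h_1)$; - $l:=genLin()$; - $cas(after.lin,null,l)$; - $before.next:=after$; - $after.seq:=before.seq+1$; - $head[pid]:=after$; 6. $head[pid]:=announce[pid]$; 7. $b:=$ the return value of operation $oid$ in the $lin$ field of the node of $oid$ in the linked list; 8. append $return(pid,m,b)$, tagged $oid$, to the recorder; 9. return $b$. Here $cas(x,null,v)$ sets $x$ to $v$ if $x$ is null and does nothing otherwise, and $genLin()$ nondeterministically yields any linearization $l$ (with operation identities) of $after.hist$ w.r.t. $Spec$ such that $l$ contains the operation of $after$ and, for each node of the linked list from the tail (excluding the sentinel) to $before$, $l$ contains the operation of that node with the return value given to it by that node's $lin$ field. **Theorem.** Let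 $Spec$ be a deterministic, non-blocking sequential specification, $n$ a natural number and $\mathcal O$ a concurrent object. Then $\mathcal O$ is linearizable w.r.t. $Spec$ for $n$ processes if and only if $[\![\mathcal O,n]\!]\preceq_{(c,r)}[\![\mathcal U_{Spec},n]\!]$. (No liveness property of $\mathcal O$ is assumed.) -/

import Mathlib

namespace Linz

universe u v w x y z t

/-! ## Labelled transition systems -/

/-- A labelled transition system over the alphabet `Label`. -/
structure LTS (Label : Type u) where
  State : Type v
  start : State
  Tr : State → Label → State → Prop

namespace LTS

variable {Label : Type u}

/-- `S.Path p l q`: there is a finite transition sequence from `p` to `q` labelled by `l`. -/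
inductive Path (S : LTS.{u, v} Label) : S.State → List Label → S.State → Prop
  | nil (p : S.State) : Path S p [] p
  | cons {p q r : S.State} {a : Label} {l : List Label} :
      S.Tr p a q → Path S q l r → Path S p (a :: l) r

/-- The finite traces: label sequences of the finite paths from the initial state. -/
def traces (S : LTS.{u, v} Label) : Set (List Label) :=
  {l | ∃ q, S.Path S.start l q}

end LTS

/-! ## Sequential specifications -/

/-- An operation `m(a) ⇒ b`. -/
structure Operation (M : Type u) (A : Type v) (B : Type w) where
  method : M
  arg : A
  res : B

/-- From each state, for each `m` and `a`, there is at most one transition whose label has the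
form `m(a) ⇒ ·`. -/
def LTS.Deterministic {M : Type u} {A : Type v} {B : Type w}
    (S : LTS.{max u v w, x} (Operation M A B)) : Prop :=
  ∀ (q : S.State) (m : M) (a : A) (b₁ b₂ : B) (q₁ q₂ : S.State),
    S.Tr q ⟨m, a, b₁⟩ q₁ → S.Tr q ⟨m, a, b₂⟩ q₂ → b₁ = b₂ ∧ q₁ = q₂

/-- From each state, for each `m` and `a`, there is at least one transition whose label has the
form `m(a) ⇒ ·`. -/
def LTS.NonBlocking {M : Type u} {A : Type v} {B : Type w}
    (S : LTS.{max u v w, x} (Operation M A B)) : Prop :=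
  ∀ (q : S.State) (m : M) (a : A), ∃ (b : B) (q' : S.State), S.Tr q ⟨m, a, b⟩ q'

/-! ## Call and return actions, histories, linearizability -/

/-- Call and return actions of `n` processes. Each action carries a tag in `T`: `T = Unit` for the
plain actions `call(i,m,a)`, `return(i,m,b)`, and the type of operation identities for actions
that additionally record the identity of their operation. -/
inductive Event (n : ℕ) (M : Type u) (A : Type v) (B : Type w) (T : Type t)
  | call (i : Fin n) (m : M) (a : A) (tag : T)
  | ret (i : Fin n) (m : M) (b : B) (tag : T)

section History

variable {n : ℕ} {M : Type u} {A : Type v} {B : Type w} {T : Type t}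

namespace Event

/-- The process of an action. -/
def pid : Event n M A B T → Fin n
  | call i _ _ _ => i
  | ret i _ _ _ => i

/-- Is the action a call action? -/
def isCall : Event n M A B T → Bool
  | call _ _ _ _ => true
  | ret _ _ _ _ => false

end Event

/-- The process subhistory `h|ᵢ`. -/
def sub (i : Fin n) (h : List (Event n M A B T)) : List (Event n M A B T) :=
  h.filter (fun e => e.pid == i)

/-- Starts with a call action; each call action is immediately followed by a matching return
action (same process, method and tag), and each return action by a call action, unless it is the
last action. -/
def IsSequential : List (Event n M A B T) → Prop
  | [] => True
  | [.call _ _ _ _] => True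
  | .call i m _ t :: .ret i' m' _ t' :: h => i = i' ∧ m = m' ∧ t = t' ∧ IsSequential h
  | _ => False

/-- A history: every return action matches the preceding call action of its process. -/
def IsHistory (h : List (Event n M A B T)) : Prop :=
  ∀ i, IsSequential (sub i h)

/-- Two histories are equivalent if all their process subhistories agree. -/
def Equivalent (h h' : List (Event n M A B T)) : Prop :=
  ∀ i, sub i h = sub i h'

/-- `complete h`, the subsequence of the matching call and return actions: drop from the history `h` the pending call actions, which are those with no later
return action of the same process. -/
def complete : List (Event n M A B T) → List (Event n M A B T)
  | [] => []
  | e :: h =>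
      if e.isCall && !(h.any fun e' => !e'.isCall && e'.pid == e.pid) then complete h
      else e :: complete h

/-- Number of call actions of process `i`. -/
def numCalls (i : Fin n) (h : List (Event n M A B T)) : ℕ :=
  h.countP (fun e => e.isCall && e.pid == i)

/-- Number of return actions of process `i`. -/
def numRets (i : Fin n) (h : List (Event n M A B T)) : ℕ :=
  h.countP (fun e => !e.isCall && e.pid == i)

/-- The happen-before relation. Operations of a history are named by pairs: `(i, k)` is the
`k`-th operation (from `0`) of process `i`, with the `k`-th call and `k`-th return action of `i`.
`(i, k)` happens before `(j, l)` if the return action of `(i, k)` occurs before the call action of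
`(j, l)`: some splitting `h = u ++ v` has the former in `u` and the latter in `v`. -/
def HappensBefore (h : List (Event n M A B T)) (i : Fin n) (k : ℕ) (j : Fin n) (l : ℕ) : Prop :=
  ∃ u v, h = u ++ v ∧ k < numRets i u ∧ numCalls j u ≤ l ∧ l < numCalls j h

/-- The sequential histories that correspond to the operation sequences in `Spec`, with arbitrary
process identities (and tags). -/
def toHistory (Spec : Set (List (Operation M A B))) : Set (List (Event n M A B T)) :=
  {h | ∃ s : List (Fin n × T × Operation M A B),
    s.map (fun o => o.2.2) ∈ Spec ∧
    h = s.flatMap (fun o =>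
      [.call o.1 o.2.2.method o.2.2.arg o.2.1, .ret o.1 o.2.2.method o.2.2.res o.2.1])}

/-- `s` is a linearization of `h` with respect to `Spec`. -/
def IsLinearization (Spec : Set (List (Operation M A B))) (h s : List (Event n M A B T)) : Prop :=
  s ∈ toHistory Spec ∧
  ∃ r : List (Event n M A B T), (∀ e ∈ r, e.isCall = false) ∧ IsHistory (h ++ r) ∧
    Equivalent (complete (h ++ r)) s ∧
    ∀ i k j l, HappensBefore (complete (h ++ r)) i k j l → HappensBefore s i k j l

/-- `h` is linearizable with respect to `Spec`. -/
def Linearizable (Spec : Set (List (Operation M A B))) (h : List (Event n M A B T)) : Prop :=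
  ∃ s, IsLinearization Spec h s

end History

/-! ## Concurrent objects and their operational semantics -/

/-- Transition labels of a concurrent system: call and return actions, and internal actions of
the processes. -/
inductive Action (n : ℕ) (M : Type u) (A : Type v) (B : Type w) (C : Type t)
  | event (e : Event n M A B Unit)
  | internal (i : Fin n) (c : C)

/-- The visible part of a label. -/
def Action.visible {n : ℕ} {M : Type u} {A : Type v} {B : Type w} {C : Type t} :
    Action n M A B C → Option (Event n M A B Unit)
  | .event e => some e
  | .internal _ _ => none

/-- The projection of a trace to call and return actions. -/
def history {n : ℕ} {M : Type u} {A : Type v} {B : Type w} {C : Type t}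
    (e : List (Action n M A B C)) : List (Event n M A B Unit) :=
  e.filterMap Action.visible

/-- A concurrent object with methods `M`, arguments in `A` and return values in `B`, as executed
by processes `0, …, n - 1`. `Shared` is the set of valuations of the shared memory, `Local` the
set of local states (control state and registers) of a process that executes a method,
`Cmd` the set of names of atomic commands. -/
structure ConcurrentObject (n : ℕ) (M : Type u) (A : Type v) (B : Type w) where
  Shared : Type x
  Local : Type y
  Cmd : Type z
  /-- the initial shared memory -/
  initShared : Shared
  /-- the local state right after the call of method `m` with argument `a` by a process -/
  entry : Fin n → M → A → Local
  /-- process `i` executes one atomic command, on its local state and the shared memory -/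
  step : Fin n → Local × Shared → Cmd → Local × Shared → Prop
  /-- in this local state process `i` may return this value -/
  exit : Fin n → Local → B → Prop

namespace ConcurrentObject

variable {n : ℕ} {M : Type u} {A : Type v} {B : Type w}

/-- Configurations of the system in which `n` processes, each running the most general client, use
the object: the shared memory, and for each process either `none` (no method is being executed)
or the method that is being executed with the local state. -/
structure Config (O : ConcurrentObject.{u, v, w, x, y, z} n M A B) where
  shared : O.Shared
  proc : Fin n → Option (M × O.Local)

/-- Transitions: an idle process may call any method with any argument; a process executing a
method may execute a command, or return when its local state permits it. -/
inductive Trans (O : ConcurrentObject.{u, v, w, x, y, z} n M A B) :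
    O.Config → Action n M A B O.Cmd → O.Config → Prop
  | call (c : O.Config) (i : Fin n) (m : M) (a : A) :
      c.proc i = none →
      Trans O c (.event (.call i m a ()))
        ⟨c.shared, Function.update c.proc i (some (m, O.entry i m a))⟩
  | step (c : O.Config) (i : Fin n) (m : M) (p p' : O.Local) (cmd : O.Cmd) (g' : O.Shared) :
      c.proc i = some (m, p) →
      O.step i (p, c.shared) cmd (p', g') →
      Trans O c (.internal i cmd) ⟨g', Function.update c.proc i (some (m, p'))⟩
  | ret (c : O.Config) (i : Fin n) (m : M) (p : O.Local) (b : B) :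
      c.proc i = some (m, p) →
      O.exit i p b →
      Trans O c (.event (.ret i m b ())) ⟨c.shared, Function.update c.proc i none⟩

/-- The operational semantics `⟦O, n⟧`. -/
def sem (O : ConcurrentObject.{u, v, w, x, y, z} n M A B) : LTS (Action n M A B O.Cmd) where
  State := O.Config
  start := ⟨O.initShared, fun _ => none⟩
  Tr := O.Trans

/-- `O` is linearizable with respect to `Spec` for `n` processes. -/
def IsLinearizable (O : ConcurrentObject.{u, v, w, x, y, z} n M A B)
    (Spec : Set (List (Operation M A B))) : Prop :=
  ∀ e ∈ O.sem.traces, Linearizable Spec (history e)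

end ConcurrentObject

/-- There is a forward simulation from `S₁` to `S₂`, with call and return actions visible and the
other actions internal. -/
def ForwardSimulated {n : ℕ} {M : Type u} {A : Type v} {B : Type w} {C₁ : Type x} {C₂ : Type y}
    (S₁ : LTS.{_, z} (Action n M A B C₁)) (S₂ : LTS.{_, t} (Action n M A B C₂)) : Prop :=
  ∃ R : S₁.State → S₂.State → Prop, R S₁.start S₂.start ∧
    ∀ c₁ c₂, R c₁ c₂ → ∀ α c₁', S₁.Tr c₁ α c₁' →
      ∃ l c₂', S₂.Path c₂ l c₂' ∧ history l = history [α] ∧ R c₁' c₂'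

/-! ## The universal construction -/

/-- Node references. The node created for the operation with identity `o` is `some o` (identities
are unique); `none` is the sentinel node that is the tail of the linked list. -/
abbrev Ref := Option ℕ

namespace Universal

section Construction

variable (n : ℕ) (M : Type u) (A : Type v) (B : Type w)

/-- Histories whose actions carry operation identities. -/
abbrev Hist := List (Event n M A B ℕ)

/-- Nodes of the linked list; `none` in an optional field is the null value. The operation
identity of a node is its reference. `inv` holds the method and the argument,
`decideNext` the state of the consensus object. -/
structure Node where
  inv : Option (M × A)
  hist : Option (Hist n M A B)
  lin : Option (Hist n M A B)
  decideNext : Option Ref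
  seq : ℕ
  next : Option Ref

/-- The shared memory: identities already produced by the identity generator, content of the
history recorder, the nodes, and the arrays `head` and `announce`. -/
structure Shared where
  used : Set ℕ
  recorder : Hist n M A B
  node : Ref → Node n M A B
  head : Fin n → Ref
  announce : Fin n → Ref

/-- Local states of a process executing `apply (m, a)`. Each constructor is the control point before
one line of the code; its arguments are the variables that are still needed. -/
inductive Local
  | genID (m : M) (a : A)
  | storeCall (m : M) (a : A) (oid : ℕ)
  | announceNode (m : M) (a : A) (oid : ℕ)
  | maxHead (m : M) (oid : ℕ)
  | loopTest (m : M) (oid : ℕ)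
  | readBefore (m : M) (oid : ℕ)
  | readHelp (m : M) (oid : ℕ) (before : Ref)
  | testHelp (m : M) (oid : ℕ) (before help : Ref)
  | preferHelp (m : M) (oid : ℕ) (before help : Ref)
  | preferOwn (m : M) (oid : ℕ) (before : Ref)
  | decide (m : M) (oid : ℕ) (before prefer : Ref)
  | readHist (m : M) (oid : ℕ) (before after : Ref)
  | casHist (m : M) (oid : ℕ) (before after : Ref) (h₁ : Hist n M A B)
  | genLin (m : M) (oid : ℕ) (before after : Ref)
  | casLin (m : M) (oid : ℕ) (before after : Ref) (l : Hist n M A B)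
  | setNext (m : M) (oid : ℕ) (before after : Ref)
  | setSeq (m : M) (oid : ℕ) (before after : Ref)
  | setHead (m : M) (oid : ℕ) (after : Ref)
  | setHeadOwn (m : M) (oid : ℕ)
  | getRetValue (m : M) (oid : ℕ)
  | storeReturn (m : M) (oid : ℕ) (b : B)
  | done (b : B)

variable {n M A B}

/-- A fresh node; all fields but the invocation are unset. -/
def newNode (inv : Option (M × A)) : Node n M A B where
  inv := inv
  hist := none
  lin := none
  decideNext := none
  seq := 0
  next := none

/-- The initial shared memory: the list consists of the sentinel node only, whose sequence number
is `1`, and all entries of `head` and `announce` refer to it. -/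
def initShared : Shared n M A B where
  used := ∅
  recorder := []
  node := fun r => if r = none then { newNode none with seq := 1 } else newNode none
  head := fun _ => none
  announce := fun _ => none

/-- Node `r'` is reached from node `r` by following `next` pointers. -/
def Reaches (g : Shared n M A B) : Ref → Ref → Prop :=
  Relation.ReflTransGen (fun r r' => (g.node r).next = some r')

/-- In the sequential history `l` the operation `oid` occurs and has return value `b`. -/
def HasRet (l : Hist n M A B) (oid : ℕ) (b : B) : Prop :=
  ∃ i m, Event.ret i m b oid ∈ l

/-- `genLin` may return `l`: it is a linearization of the `hist` field of `after`, it contains the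
operation of `after`, and for every node of the linked list (from the tail to `before`) it contains
the operation of that node, with the return value that the `lin` field of that node gives it. -/
def GenLin (Spec : Set (List (Operation M A B))) (g : Shared n M A B) (before after : Ref)
    (l : Hist n M A B) : Prop :=
  (∃ h, (g.node after).hist = some h ∧ IsLinearization Spec h l) ∧
  (∃ o b, after = some o ∧ HasRet l o b) ∧
  (∀ o : ℕ, Reaches g none (some o) → Reaches g (some o) before →
    ∃ l₀ b, (g.node (some o)).lin = some l₀ ∧ HasRet l₀ o b ∧ HasRet l o b)

/-- Write the node at reference `r`. -/
def setNode (g : Shared n M A B) (r : Ref) (nd : Node n M A B) : Shared n M A B :=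
  { g with node := Function.update g.node r nd }

/-- Write the array entry `head[i]`. -/
def setHead (g : Shared n M A B) (i : Fin n) (r : Ref) : Shared n M A B :=
  { g with head := Function.update g.head i r }

/-- The index `k % n`; there is a process `i`, so `n` is positive. -/
def modIndex (i : Fin n) (k : ℕ) : Fin n := ⟨k % n, Nat.mod_lt k i.pos⟩

/-- The code of `apply`, run by process `i`; each line is one atomic command.
An update `x := x.or (some v)` is `cas(x, null, v)`. -/
inductive Step (Spec : Set (List (Operation M A B))) (i : Fin n) :
    Local n M A B × Shared n M A B → Local n M A B × Shared n M A B → Prop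
  /-- `oid := genID()` -/
  | genID (g : Shared n M A B) (m : M) (a : A) (oid : ℕ) :
      oid ∉ g.used →
      Step Spec i (.genID m a, g) (.storeCall m a oid, { g with used := insert oid g.used })
  /-- `storeCall(m, a, pid, oid)` -/
  | storeCall (g : Shared n M A B) (m : M) (a : A) (oid : ℕ) :
      Step Spec i (.storeCall m a oid, g)
        (.announceNode m a oid, { g with recorder := g.recorder ++ [.call i m a oid] })
  /-- `announce[pid] := new Node(m, a, oid)` -/
  | announceNode (g : Shared n M A B) (m : M) (a : A) (oid : ℕ) :
      Step Spec i (.announceNode m a oid, g)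
        (.maxHead m oid, { setNode g (some oid) (newNode (some (m, a))) with
          announce := Function.update g.announce i (some oid) })
  /-- `head[pid] := Node.max(head)` -/
  | maxHead (g : Shared n M A B) (m : M) (oid : ℕ) (j : Fin n) :
      (∀ k, (g.node (g.head k)).seq ≤ (g.node (g.head j)).seq) →
      Step Spec i (.maxHead m oid, g) (.loopTest m oid, setHead g i (g.head j))
  /-- `while (announce[pid].seq == 0)`, the loop is entered -/
  | loopEnter (g : Shared n M A B) (m : M) (oid : ℕ) :
      (g.node (g.announce i)).seq = 0 →
      Step Spec i (.loopTest m oid, g) (.readBefore m oid, g)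
  /-- `while (announce[pid].seq == 0)`, the loop is left -/
  | loopExit (g : Shared n M A B) (m : M) (oid : ℕ) :
      (g.node (g.announce i)).seq ≠ 0 →
      Step Spec i (.loopTest m oid, g) (.setHeadOwn m oid, g)
  /-- `before := head[pid]` -/
  | readBefore (g : Shared n M A B) (m : M) (oid : ℕ) :
      Step Spec i (.readBefore m oid, g) (.readHelp m oid (g.head i), g)
  /-- `help := announce[(before.seq + 1) % n]` -/
  | readHelp (g : Shared n M A B) (m : M) (oid : ℕ) (before : Ref) :
      Step Spec i (.readHelp m oid before, g)
        (.testHelp m oid before (g.announce (modIndex i ((g.node before).seq + 1))), g)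
  /-- `if (help.seq == 0)`, first branch -/
  | testHelpZero (g : Shared n M A B) (m : M) (oid : ℕ) (before help : Ref) :
      (g.node help).seq = 0 →
      Step Spec i (.testHelp m oid before help, g) (.preferHelp m oid before help, g)
  /-- `if (help.seq == 0)`, second branch -/
  | testHelpNonzero (g : Shared n M A B) (m : M) (oid : ℕ) (before help : Ref) :
      (g.node help).seq ≠ 0 →
      Step Spec i (.testHelp m oid before help, g) (.preferOwn m oid before, g)
  /-- `prefer := help` -/
  | preferHelp (g : Shared n M A B) (m : M) (oid : ℕ) (before help : Ref) :
      Step Spec i (.preferHelp m oid before help, g) (.decide m oid before help, g)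
  /-- `prefer := announce[pid]` -/
  | preferOwn (g : Shared n M A B) (m : M) (oid : ℕ) (before : Ref) :
      Step Spec i (.preferOwn m oid before, g) (.decide m oid before (g.announce i), g)
  /-- `after := before.decideNext.decide(prefer)`: the first proposal is stored, and the stored
  node is returned -/
  | decide (g : Shared n M A B) (m : M) (oid : ℕ) (before prefer : Ref) :
      Step Spec i (.decide m oid before prefer, g)
        (.readHist m oid before ((g.node before).decideNext.getD prefer),
          setNode g before { g.node before with
            decideNext := (g.node before).decideNext.or (some prefer) })
  /-- `h₁ := read()` -/
  | readHist (g : Shared n M A B) (m : M) (oid : ℕ) (before after : Ref) :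
      Step Spec i (.readHist m oid before after, g) (.casHist m oid before after g.recorder, g)
  /-- `cas(after.hist, null, h₁)` -/
  | casHist (g : Shared n M A B) (m : M) (oid : ℕ) (before after : Ref) (h₁ : Hist n M A B) :
      Step Spec i (.casHist m oid before after h₁, g)
        (.genLin m oid before after,
          setNode g after { g.node after with hist := (g.node after).hist.or (some h₁) })
  /-- `l := genLin()` -/
  | genLin (g : Shared n M A B) (m : M) (oid : ℕ) (before after : Ref) (l : Hist n M A B) :
      GenLin Spec g before after l →
      Step Spec i (.genLin m oid before after, g) (.casLin m oid before after l, g)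
  /-- `cas(after.lin, null, l)` -/
  | casLin (g : Shared n M A B) (m : M) (oid : ℕ) (before after : Ref) (l : Hist n M A B) :
      Step Spec i (.casLin m oid before after l, g)
        (.setNext m oid before after,
          setNode g after { g.node after with lin := (g.node after).lin.or (some l) })
  /-- `before.next := after` -/
  | setNext (g : Shared n M A B) (m : M) (oid : ℕ) (before after : Ref) :
      Step Spec i (.setNext m oid before after, g)
        (.setSeq m oid before after, setNode g before { g.node before with next := some after })
  /-- `after.seq := before.seq + 1` -/
  | setSeq (g : Shared n M A B) (m : M) (oid : ℕ) (before after : Ref) :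
      Step Spec i (.setSeq m oid before after, g)
        (.setHead m oid after,
          setNode g after { g.node after with seq := (g.node before).seq + 1 })
  /-- `head[pid] := after`, end of the loop body -/
  | setHead (g : Shared n M A B) (m : M) (oid : ℕ) (after : Ref) :
      Step Spec i (.setHead m oid after, g) (.loopTest m oid, Universal.setHead g i after)
  /-- `head[pid] := announce[pid]` -/
  | setHeadOwn (g : Shared n M A B) (m : M) (oid : ℕ) :
      Step Spec i (.setHeadOwn m oid, g)
        (.getRetValue m oid, Universal.setHead g i (g.announce i))
  /-- `b := getRetValue(oid)`: find the node of `oid` in the linked list, and return the value that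
  its `lin` field gives to `oid` -/
  | getRetValue (g : Shared n M A B) (m : M) (oid : ℕ) (l : Hist n M A B) (b : B) :
      Reaches g none (some oid) →
      (g.node (some oid)).lin = some l →
      HasRet l oid b →
      Step Spec i (.getRetValue m oid, g) (.storeReturn m oid b, g)
  /-- `storeReturn(m, b, pid, oid)` -/
  | storeReturn (g : Shared n M A B) (m : M) (oid : ℕ) (b : B) :
      Step Spec i (.storeReturn m oid b, g)
        (.done b, { g with recorder := g.recorder ++ [.ret i m b oid] })

end Construction

end Universal

/-- The universal construction `U_Spec` for `n` processes. A call `apply(m, a)` that returns `b` is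
regarded as the operation `m(a) ⇒ b`. -/
def USpec {M : Type u} {A : Type v} {B : Type w} (Spec : Set (List (Operation M A B))) (n : ℕ) :
    ConcurrentObject n M A B where
  Shared := Universal.Shared n M A B
  Local := Universal.Local n M A B
  Cmd := Unit
  initShared := Universal.initShared
  entry := fun _ m a => .genID m a
  step := fun i s _ s' => Universal.Step Spec i s s'
  exit := fun _ p b => p = .done b

end Linz

/-!
# Linearizability as forward simulation by the universal construction

*Linearizability as a local condition.* A sequential history `s` linearizes `h` iff it belongs to
the specification, each process subhistory of `s` is a completion of that of `h` (the pending call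
is dropped or gets a matching return), and `s` respects the happen-before pairs of `h` between
operations of `s` (`isLinearization_iff`). In this form linearizations are easily transferred
between histories with and without operation identities, and between a history and its extensions.

*The universal construction is linearizable* (`USpec_isLinearizable`), hence so is every object that
it simulates. The consensus objects `decideNext` order the decided nodes in a chain. A process
proposes to the node `before` only a node that is not among those decided up to `before`, and the
first proposal arrives when `before` is the last node of the chain, so no node is decided twice. The
`lin` field of a decided node is written once, with a linearization of a prefix of the recorded
history that agrees with the values fixed by all earlier nodes. A recorded return takes its value
from such a field. So the linearization in the last node that has one contains all completed
operations with their return values; operations called after the prefix was read are pending. It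
therefore linearizes the whole recorder (`Completion.of_prefix`), and then the actual
history, in which operations only last longer (`RecInv`, `Universal.SysInv.linearizable`).

*A linearizable object is simulated* (`ConcurrentObject.IsLinearizable.forwardSimulated`). The
universal construction answers a call by recording it, without announcing the operation, and ignores
the internal steps of the object. When the object returns a value, the process announces its
operation and runs alone until it has appended its node to the list (`Universal.Quiet.run`). It
chooses the linearization after the object did: the history with the new return is linearizable, and
any linearization of it keeps the values of all operations that have returned, which are exactly
those in the list. Nothing commits the construction to the values of pending operations, because
operations that are not announced are not helped.
-/

namespace Linz

/-! ### Counting calls and returns, and the happen-before relation -/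

section History

variable {n : ℕ} {M A B T : Type*}

namespace Event

/-- Forget the tag of an action. -/
def untag : Event n M A B T → Event n M A B Unit
  | call i m a _ => call i m a ()
  | ret i m b _ => ret i m b ()

@[simp] lemma pid_untag (e : Event n M A B T) : e.untag.pid = e.pid := by cases e <;> rfl

@[simp] lemma isCall_untag (e : Event n M A B T) : e.untag.isCall = e.isCall := by cases e <;> rfl

end Event

/-- Forget the tags of a list of actions. -/
def untag (h : List (Event n M A B T)) : List (Event n M A B Unit) := h.map Event.untag

@[simp] lemma untag_nil : untag ([] : List (Event n M A B T)) = [] := rfl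

@[simp] lemma untag_append (h h' : List (Event n M A B T)) :
    untag (h ++ h') = untag h ++ untag h' := List.map_append

@[simp] lemma untag_cons (e : Event n M A B T) (h : List (Event n M A B T)) :
    untag (e :: h) = e.untag :: untag h := rfl

@[simp] lemma sub_nil (i : Fin n) : sub i ([] : List (Event n M A B T)) = [] := rfl

@[simp] lemma sub_append (i : Fin n) (h h' : List (Event n M A B T)) :
    sub i (h ++ h') = sub i h ++ sub i h' := List.filter_append ..

lemma sub_cons (i : Fin n) (e : Event n M A B T) (h : List (Event n M A B T)) :
    sub i (e :: h) = if e.pid = i then e :: sub i h else sub i h := by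
  simp [sub, List.filter_cons]

lemma sub_untag (i : Fin n) (h : List (Event n M A B T)) : sub i (untag h) = untag (sub i h) := by
  induction h with
  | nil => rfl
  | cons e h ih => simp only [untag_cons, sub_cons, Event.pid_untag, ih]; split <;> rfl

lemma mem_sub {i : Fin n} {h : List (Event n M A B T)} {e : Event n M A B T} :
    e ∈ sub i h ↔ e ∈ h ∧ e.pid = i := by simp [sub]

@[simp] lemma numCalls_nil (i : Fin n) : numCalls i ([] : List (Event n M A B T)) = 0 := rfl
@[simp] lemma numRets_nil (i : Fin n) : numRets i ([] : List (Event n M A B T)) = 0 := rfl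

@[simp] lemma numCalls_append (i : Fin n) (h h' : List (Event n M A B T)) :
    numCalls i (h ++ h') = numCalls i h + numCalls i h' := List.countP_append ..

@[simp] lemma numRets_append (i : Fin n) (h h' : List (Event n M A B T)) :
    numRets i (h ++ h') = numRets i h + numRets i h' := List.countP_append ..

lemma numCalls_cons (i : Fin n) (e : Event n M A B T) (h : List (Event n M A B T)) :
    numCalls i (e :: h) = numCalls i h + if e.isCall && e.pid == i then 1 else 0 :=
  List.countP_cons ..

lemma numRets_cons (i : Fin n) (e : Event n M A B T) (h : List (Event n M A B T)) :
    numRets i (e :: h) = numRets i h + if !e.isCall && e.pid == i then 1 else 0 :=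
  List.countP_cons ..

lemma numCalls_sub (i : Fin n) (h : List (Event n M A B T)) :
    numCalls i (sub i h) = numCalls i h := by
  simp only [numCalls, sub, List.countP_filter]
  congr 1; ext e; simp

lemma numRets_sub (i : Fin n) (h : List (Event n M A B T)) : numRets i (sub i h) = numRets i h := by
  simp only [numRets, sub, List.countP_filter]
  congr 1; ext e; simp

@[simp] lemma numCalls_untag (i : Fin n) (h : List (Event n M A B T)) :
    numCalls i (untag h) = numCalls i h := by
  simp only [numCalls, untag, List.countP_map]
  congr 1; ext e; simp

@[simp] lemma numRets_untag (i : Fin n) (h : List (Event n M A B T)) :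
    numRets i (untag h) = numRets i h := by
  simp only [numRets, untag, List.countP_map]
  congr 1; ext e; simp

lemma happensBefore_untag {h : List (Event n M A B T)} {i j : Fin n} {k l : ℕ} :
    HappensBefore (untag h) i k j l ↔ HappensBefore h i k j l := by
  constructor
  · rintro ⟨u, v, huv, h1, h2, h3⟩
    obtain ⟨u, v, rfl, rfl, rfl⟩ := List.map_eq_append_iff.1 huv
    change k < numRets i (untag u) at h1
    change numCalls j (untag u) ≤ l at h2
    exact ⟨u, v, rfl, by simpa using h1, by simpa using h2, by simpa using h3⟩
  · rintro ⟨u, v, rfl, h1, h2, h3⟩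
    exact ⟨untag u, untag v, by simp, by simpa, by simpa, by simpa using h3⟩

lemma HappensBefore.append {h : List (Event n M A B T)} {i j : Fin n} {k l : ℕ}
    (H : HappensBefore h i k j l) (w : List (Event n M A B T)) :
    HappensBefore (h ++ w) i k j l := by
  obtain ⟨u, v, rfl, h1, h2, h3⟩ := H
  exact ⟨u, v ++ w, by simp, h1, h2, by simp at h3 ⊢; omega⟩

/-- Happen-before facts about operations that are called in a prefix are facts of the prefix. -/
lemma HappensBefore.of_append {h w : List (Event n M A B T)} {i j : Fin n} {k l : ℕ}
    (H : HappensBefore (h ++ w) i k j l) (hl : l < numCalls j h) : HappensBefore h i k j l := by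
  obtain ⟨u, v, huv, h1, h2, -⟩ := H
  rcases List.append_eq_append_iff.1 huv with ⟨x, rfl, rfl⟩ | ⟨x, rfl, rfl⟩
  · simp at h2; omega
  · exact ⟨u, x, rfl, h1, h2, hl⟩

lemma HappensBefore.of_prefix {h h' : List (Event n M A B T)} {i j : Fin n} {k l : ℕ}
    (H : HappensBefore h' i k j l) (hp : h <+: h') (hl : l < numCalls j h) :
    HappensBefore h i k j l := by
  obtain ⟨w, rfl⟩ := hp
  exact H.of_append hl

/-! ### Completions of process subhistories -/

/-- A sequence of calls, each followed by a matching return. -/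
inductive Paired : List (Event n M A B T) → Prop
  | nil : Paired []
  | cons (i : Fin n) (m : M) (a : A) (b : B) (t : T) {p : List (Event n M A B T)} :
      Paired p → Paired (.call i m a t :: .ret i m b t :: p)

/-- `Completion p c`: the sequential list `c` of complete operations arises from `p` by
dropping the pending call of `p`, if there is one, or by completing it with a matching return. -/
inductive Completion : List (Event n M A B T) → List (Event n M A B T) → Prop
  | nil : Completion [] []
  | drop (i : Fin n) (m : M) (a : A) (t : T) : Completion [.call i m a t] []
  | finish (i : Fin n) (m : M) (a : A) (b : B) (t : T) :
      Completion [.call i m a t] [.call i m a t, .ret i m b t]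
  | cons (i : Fin n) (m : M) (a : A) (b : B) (t : T) {p c : List (Event n M A B T)} :
      Completion p c →
      Completion (.call i m a t :: .ret i m b t :: p) (.call i m a t :: .ret i m b t :: c)

lemma Paired.append {p q : List (Event n M A B T)} (hp : Paired p) (hq : Paired q) :
    Paired (p ++ q) := by
  induction hp with
  | nil => exact hq
  | cons i m a b t _ ih => exact .cons i m a b t ih

lemma Paired.untag {p : List (Event n M A B T)} (hp : Paired p) : Paired (untag p) := by
  induction hp with
  | nil => exact .nil
  | cons i m a b t _ ih => exact .cons i m a b () ih

lemma Paired.completion_append {p q c : List (Event n M A B T)} (hp : Paired p)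
    (hq : Completion q c) : Completion (p ++ q) (p ++ c) := by
  induction hp with
  | nil => exact hq
  | cons i m a b t _ ih => exact .cons i m a b t ih

lemma Paired.completion {p : List (Event n M A B T)} (hp : Paired p) : Completion p p := by
  simpa using hp.completion_append .nil

lemma Paired.eq_of_completion {p c : List (Event n M A B T)} (hp : Paired p)
    (h : Completion p c) : c = p := by
  induction hp generalizing c with
  | nil => cases h; rfl
  | cons i m a b t _ ih => cases h with
    | cons _ _ _ _ _ h => rw [ih h]

lemma Completion.untag {p c : List (Event n M A B T)} (h : Completion p c) :
    Completion (untag p) (untag c) := by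
  induction h with
  | nil => exact .nil
  | drop i m a t => exact .drop i m a ()
  | finish i m a b t => exact .finish i m a b ()
  | cons i m a b t _ ih => exact .cons i m a b () ih

lemma Completion.paired {p c : List (Event n M A B T)} (h : Completion p c) : Paired c := by
  induction h with
  | nil => exact .nil
  | drop i m a t => exact .nil
  | finish i m a b t => exact .cons _ _ _ _ _ .nil
  | cons i m a b t _ ih => exact .cons _ _ _ _ _ ih

lemma Completion.ret_mem {p c : List (Event n M A B T)} (h : Completion p c)
    {i : Fin n} {m : M} {b : B} {t : T} (hm : Event.ret i m b t ∈ p) : Event.ret i m b t ∈ c := by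
  induction h with
  | nil => exact hm
  | drop => simp at hm
  | finish => simp at hm
  | cons _ _ _ _ _ _ ih => simp at hm ⊢; exact hm.imp_right ih

lemma Completion.call_mem {p c : List (Event n M A B T)} (h : Completion p c)
    {i : Fin n} {m : M} {a : A} {t : T} (hm : Event.call i m a t ∈ c) :
    Event.call i m a t ∈ p := by
  induction h with
  | nil => exact hm
  | drop => simp at hm
  | finish => simpa using hm
  | cons _ _ _ _ _ _ ih => simp at hm ⊢; exact hm.imp_right ih

lemma Completion.numCalls_le {p c : List (Event n M A B T)} (h : Completion p c) (i : Fin n) :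
    numCalls i c ≤ numCalls i p := by
  induction h with
  | nil => exact le_rfl
  | drop => simp
  | finish => simp [numCalls_cons, Event.isCall]
  | cons _ _ _ _ _ _ ih => simp only [numCalls_cons]; omega

lemma Paired.exists_call {p : List (Event n M A B T)} (h : Paired p)
    {i : Fin n} {m : M} {b : B} {t : T} (hm : Event.ret i m b t ∈ p) :
    ∃ a, Event.call i m a t ∈ p := by
  induction h with
  | nil => simp at hm
  | cons i' m' a' b' t' _ ih =>
    simp at hm
    rcases hm with ⟨rfl, rfl, rfl, rfl⟩ | hm
    · exact ⟨a', by simp⟩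
    · obtain ⟨a, ha⟩ := ih hm
      exact ⟨a, by simp [ha]⟩

lemma Completion.isSequential {p c : List (Event n M A B T)} (h : Completion p c) :
    IsSequential p := by
  induction h with
  | nil => trivial
  | drop => trivial
  | finish => trivial
  | cons _ _ _ _ _ _ ih => exact ⟨rfl, rfl, rfl, ih⟩

/-! ### Linearizability in terms of completions -/

lemma complete_call_ret (i : Fin n) (m : M) (a : A) (b : B) (t : T) (h : List (Event n M A B T)) :
    complete (.call i m a t :: .ret i m b t :: h) =
      .call i m a t :: .ret i m b t :: complete h := by
  simp [complete, Event.isCall, Event.pid]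

lemma sub_complete (i : Fin n) (h : List (Event n M A B T)) :
    sub i (complete h) = complete (sub i h) := by
  induction h with
  | nil => rfl
  | cons e h ih =>
    have key : e.pid = i →
        ((sub i h).any fun e' => !e'.isCall && e'.pid == e.pid) =
          h.any fun e' => !e'.isCall && e'.pid == e.pid := by
      rintro rfl
      simp only [sub, List.any_filter]
      congr 1; ext e'; cases e'.pid == e.pid <;> simp
    by_cases he : e.pid = i
    · rw [sub_cons, if_pos he, complete, complete, key he]
      split
      · exact ih
      · rw [sub_cons, if_pos he, ih]
    · rw [sub_cons, if_neg he, complete]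
      split
      · exact ih
      · rw [sub_cons, if_neg he, ih]

lemma completion_complete {p r : List (Event n M A B T)} (hr : ∀ e ∈ r, e.isCall = false)
    (h : IsSequential (p ++ r)) : Completion p (complete (p ++ r)) := by
  induction p using IsSequential.induct with
  | case1 =>
    cases r with
    | nil => exact .nil
    | cons e r =>
      cases e with
      | call => simp [Event.isCall] at hr
      | ret => simp [IsSequential] at h
  | case2 i m a t =>
    cases r with
    | nil => simpa [complete, Event.isCall] using Completion.drop i m a t
    | cons e r =>
      cases e with
      | call => simp [Event.isCall] at hr
      | ret i' m' b t' =>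
        obtain ⟨rfl, rfl, rfl, h⟩ := h
        cases r with
        | nil => simpa [complete_call_ret, complete] using Completion.finish i m a b t
        | cons e r =>
          cases e with
          | call => simp [Event.isCall] at hr
          | ret => simp [IsSequential] at h
  | case3 i m a t i' m' b t' p ih =>
    obtain ⟨rfl, rfl, rfl, h⟩ := h
    simp only [List.cons_append, complete_call_ret]
    exact .cons i m a b t (ih h)
  | case4 p h1 h2 h3 =>
    exfalso
    match p, h1, h2, h3 with
    | .ret _ _ _ _ :: p, _, _, _ => simp [IsSequential] at h
    | .call _ _ _ _ :: .call _ _ _ _ :: p, _, _, _ => simp [IsSequential] at h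
    | [.call _ _ _ _], _, h2, _ => exact h2 _ _ _ _ rfl
    | .call _ _ _ _ :: .ret _ _ _ _ :: p, _, _, h3 => exact h3 _ _ _ _ _ _ _ _ _ rfl

/-- Every completion is realized by appending a list of returns. -/
lemma Completion.exists_rets {p c : List (Event n M A B T)} (h : Completion p c) {i : Fin n}
    (hp : ∀ e ∈ p, e.pid = i) :
    ∃ r : List (Event n M A B T), (∀ e ∈ r, e.isCall = false) ∧ (∀ e ∈ r, e.pid = i) ∧
      IsSequential (p ++ r) ∧ complete (p ++ r) = c := by
  induction h with
  | nil => exact ⟨[], by simp, by simp, trivial, rfl⟩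
  | drop i m a t => exact ⟨[], by simp, by simp, trivial, by simp [complete, Event.isCall]⟩
  | finish i' m a b t =>
    refine ⟨[.ret i' m b t], by simp [Event.isCall], ?_, ⟨rfl, rfl, rfl, trivial⟩, ?_⟩
    · simpa [Event.pid] using hp
    · simp [complete_call_ret, complete]
  | cons i' m a b t _ ih =>
    obtain ⟨r, h1, h2, h3, h4⟩ := ih fun e he => hp e (by simp [he])
    exact ⟨r, h1, h2, ⟨rfl, rfl, rfl, h3⟩, by simp [complete_call_ret, h4]⟩

lemma sub_flatMap_finRange {f : Fin n → List (Event n M A B T)} (hf : ∀ i, ∀ e ∈ f i, e.pid = i)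
    (i : Fin n) : sub i ((List.finRange n).flatMap f) = f i := by
  have key : ∀ L : List (Fin n), L.Nodup →
      sub i (L.flatMap f) = if i ∈ L then f i else [] := by
    intro L hL
    induction L with
    | nil => rfl
    | cons j L ih =>
      obtain ⟨hj, hL⟩ := List.nodup_cons.1 hL
      rw [List.flatMap_cons, sub_append, ih hL]
      by_cases hij : i = j
      · subst hij
        have : sub i (f i) = f i := by
          simp only [sub, List.filter_eq_self]
          intro e he; simp [hf i e he]
        simp [hj, this]
      · have : sub i (f j) = [] := by
          simp only [sub, List.filter_eq_nil_iff]
          intro e he; simp [hf j e he, Ne.symm hij]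
        simp [hij, this]
  rw [key _ (List.nodup_finRange n)]
  simp

/-- Deleting the pending calls from `u ++ v` leaves all returns of `u`. -/
lemma complete_append (u v : List (Event n M A B T)) :
    ∃ u', complete (u ++ v) = u' ++ complete v ∧ (∀ i, numRets i u' = numRets i u) ∧
      ∀ i, numCalls i u' ≤ numCalls i u := by
  induction u with
  | nil => exact ⟨[], rfl, fun _ => rfl, fun _ => le_rfl⟩
  | cons e u ih =>
    obtain ⟨u', h1, h2, h3⟩ := ih
    rw [List.cons_append, complete]
    split
    · rename_i hc
      simp only [Bool.and_eq_true] at hc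
      refine ⟨u', h1, fun i => ?_, fun i => ?_⟩
      · simp [numRets_cons, hc.1, h2]
      · rw [numCalls_cons]; have := h3 i; omega
    · refine ⟨e :: u', by simp [h1], fun i => ?_, fun i => ?_⟩
      · simp [numRets_cons, h2]
      · simp only [numCalls_cons]; have := h3 i; omega

lemma numCalls_complete_eq_zero {j : Fin n} {v : List (Event n M A B T)} (h : numRets j v = 0) :
    numCalls j (complete v) = 0 := by
  induction v with
  | nil => rfl
  | cons e v ih =>
    have h' : numRets j v = 0 := by rw [numRets_cons] at h; omega
    rw [complete]
    split
    · exact ih h'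
    · rename_i hc
      rw [numCalls_cons, ih h']
      split
      · rename_i he
        simp only [Bool.and_eq_true, beq_iff_eq] at he
        exfalso
        apply hc
        obtain ⟨he, rfl⟩ := he
        simp only [he, Bool.true_and, Bool.not_eq_true', List.any_eq_false]
        exact List.countP_eq_zero.1 h'
      · rfl

lemma exists_split_of_complete {x u' v' : List (Event n M A B T)} (h : complete x = u' ++ v') :
    ∃ u v, x = u ++ v ∧ complete v = v' ∧ (∀ i, numRets i u' = numRets i u) ∧
      ∀ j, numCalls j u' = numCalls j u ∨ numRets j v = 0 := by
  induction x generalizing u' with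
  | nil =>
    obtain ⟨rfl, rfl⟩ := List.append_eq_nil_iff.1 h.symm
    exact ⟨[], [], rfl, rfl, fun _ => rfl, fun _ => .inl rfl⟩
  | cons e x ih =>
    rw [complete] at h
    split at h
    · rename_i hc
      simp only [Bool.and_eq_true, Bool.not_eq_true', List.any_eq_false] at hc
      obtain ⟨u, v, rfl, h2, h3, h4⟩ := ih h
      refine ⟨e :: u, v, rfl, h2, fun i => by simp [numRets_cons, hc.1, h3], fun j => ?_⟩
      by_cases hj : e.pid = j
      · right
        subst hj
        have : numRets e.pid (u ++ v) = 0 := List.countP_eq_zero.2 (by simpa using hc.2)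
        simp at this; exact this.2
      · simpa [numCalls_cons, hj] using h4 j
    · rename_i hc
      cases u' with
      | nil =>
        refine ⟨[], e :: x, rfl, ?_, fun _ => rfl, fun _ => .inl rfl⟩
        rw [complete, if_neg hc]; simpa using h
      | cons e' u' =>
        obtain ⟨rfl, h'⟩ := List.cons.inj h
        obtain ⟨u, v, rfl, h2, h3, h4⟩ := ih h'
        refine ⟨e :: u, v, rfl, h2, fun i => by simp [numRets_cons, h3], fun j => ?_⟩
        simpa [numCalls_cons] using h4 j

lemma Equivalent.numCalls_eq {h h' : List (Event n M A B T)} (H : Equivalent h h') (j : Fin n) :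
    numCalls j h = numCalls j h' := by
  rw [← numCalls_sub, H j, numCalls_sub]

/-- Linearizability process by process: `s` is a linearization of `h` if each process subhistory of
`s` is a completion of the one of `h` and `s` respects the happen-before relation of `h` between
the operations that `s` contains. -/
theorem isLinearization_iff {Spec : Set (List (Operation M A B))} {h s : List (Event n M A B T)} :
    IsLinearization Spec h s ↔ s ∈ toHistory Spec ∧ (∀ i, Completion (sub i h) (sub i s)) ∧
      ∀ i k j l, HappensBefore h i k j l → l < numCalls j s → HappensBefore s i k j l := by
  constructor
  · rintro ⟨hs, r, hr, hh, heq, hb⟩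
    refine ⟨hs, fun i => ?_, fun i k j l hkl hl => hb _ _ _ _ ?_⟩
    · have := hh i
      rw [sub_append] at this
      rw [← heq i, sub_complete, sub_append]
      exact completion_complete (fun e he => hr e (mem_sub.1 he).1) this
    · obtain ⟨u, v, rfl, h1, h2, -⟩ := hkl
      rw [← heq.numCalls_eq] at hl
      rw [List.append_assoc] at hl ⊢
      obtain ⟨u', e1, e2, e3⟩ := complete_append u (v ++ r)
      exact ⟨u', _, e1, by rwa [e2], (e3 j).trans h2, hl⟩
  · rintro ⟨hs, hc, hb⟩
    choose r r1 r2 r3 r4 using fun i => (hc i).exists_rets (i := i) (fun e he => (mem_sub.1 he).2)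
    have hsub := sub_flatMap_finRange r2
    set R := (List.finRange n).flatMap r with hR
    have hRr : ∀ e ∈ R, e.isCall = false := by
      intro e he
      obtain ⟨i, -, hi⟩ := List.mem_flatMap.1 he
      exact r1 i e hi
    have heq : Equivalent (complete (h ++ R)) s := fun i => by
      rw [sub_complete, sub_append, hsub, r4]
    refine ⟨hs, R, hRr, fun i => ?_, heq, ?_⟩
    · rw [sub_append, hsub]; exact r3 i
    · rintro i k j l ⟨u', v', huv, h1, h2, h3⟩
      obtain ⟨u, v, e1, e2, e3, e4⟩ := exists_split_of_complete huv
      have hlt := h3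
      rw [heq.numCalls_eq] at hlt
      have hle : numCalls j u ≤ l := by
        rcases e4 j with e4 | e4
        · rwa [← e4]
        · rw [huv, numCalls_append, ← e2, numCalls_complete_eq_zero e4] at h3; omega
      have hcall : numCalls j s ≤ numCalls j h := by
        rw [← numCalls_sub, ← numCalls_sub j h]; exact (hc j).numCalls_le j
      refine hb _ _ _ _ (HappensBefore.of_append (w := R) ⟨u, v, e1, by rwa [← e3], hle, ?_⟩ ?_) hlt
      · rw [numCalls_append]; omega
      · omega

lemma IsLinearization.of_append_ret {Spec : Set (List (Operation M A B))}
    {h s : List (Event n M A B T)} {e : Event n M A B T} (he : e.isCall = false)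
    (hs : IsLinearization Spec (h ++ [e]) s) : IsLinearization Spec h s := by
  obtain ⟨h1, r, h2, h3⟩ := hs
  refine ⟨h1, e :: r, ?_, ?_⟩
  · simpa [he] using h2
  · simpa using h3

lemma IsLinearization.ret_mem {Spec : Set (List (Operation M A B))}
    {h s : List (Event n M A B T)} (hs : IsLinearization Spec h s)
    {i : Fin n} {m : M} {b : B} {t : T} (hm : Event.ret i m b t ∈ h) :
    Event.ret i m b t ∈ s :=
  (mem_sub.1 (((isLinearization_iff.1 hs).2.1 i).ret_mem (mem_sub.2 ⟨hm, rfl⟩))).1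

/-! ### Adding and removing tags -/

lemma untag_mem_toHistory {Spec : Set (List (Operation M A B))} {s : List (Event n M A B T)}
    (hs : s ∈ toHistory Spec) : untag s ∈ toHistory Spec := by
  obtain ⟨σ, h1, rfl⟩ := hs
  refine ⟨σ.map fun o => (o.1, (), o.2.2), by simpa [Function.comp_def] using h1, ?_⟩
  clear h1
  induction σ with
  | nil => rfl
  | cons o σ ih =>
    rw [List.flatMap_cons, untag_append, ih]
    rfl

/-- Tags can be put on the completion of an untagged list. -/
lemma Completion.exists_tagged {p : List (Event n M A B T)} (hp : IsSequential p)
    {c : List (Event n M A B Unit)} (h : Completion (Linz.untag p) c) :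
    ∃ c', Completion p c' ∧ Linz.untag c' = c := by
  induction p using IsSequential.induct generalizing c with
  | case1 => cases h; exact ⟨[], .nil, rfl⟩
  | case2 i m a t =>
    cases h with
    | drop => exact ⟨[], .drop _ _ _ _, rfl⟩
    | finish _ _ _ b => exact ⟨_, .finish i m a b t, rfl⟩
  | case3 i m a t i' m' b t' p ih =>
    obtain ⟨rfl, rfl, rfl, hp⟩ := hp
    cases h with
    | cons _ _ _ _ _ h =>
      obtain ⟨c', h1, h2⟩ := ih hp h
      exact ⟨_, .cons i m a b t h1, by rw [← h2]; rfl⟩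
  | case4 p h1 h2 h3 =>
    rw [IsSequential] at hp
    · exact hp.elim
    all_goals assumption

/-- A sequential history gets tags from tagged versions of its process subhistories. -/
lemma exists_tagged_of_sub (σ : List (Fin n × Unit × Operation M A B))
    (c : Fin n → List (Event n M A B T)) (hc : ∀ i, Paired (c i))
    (h : ∀ i, untag (c i) = sub i (σ.flatMap (fun o =>
      [.call o.1 o.2.2.method o.2.2.arg o.2.1, .ret o.1 o.2.2.method o.2.2.res o.2.1]))) :
    ∃ τ : List (Fin n × T × Operation M A B), τ.map (fun o => o.2.2) = σ.map (fun o => o.2.2) ∧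
      untag (τ.flatMap (fun o =>
        [.call o.1 o.2.2.method o.2.2.arg o.2.1, .ret o.1 o.2.2.method o.2.2.res o.2.1])) =
      σ.flatMap (fun o =>
        [.call o.1 o.2.2.method o.2.2.arg o.2.1, .ret o.1 o.2.2.method o.2.2.res o.2.1]) ∧
      ∀ i, sub i (τ.flatMap (fun o =>
        [.call o.1 o.2.2.method o.2.2.arg o.2.1, .ret o.1 o.2.2.method o.2.2.res o.2.1])) =
          c i := by
  induction σ generalizing c with
  | nil =>
    refine ⟨[], rfl, rfl, fun i => ?_⟩
    have := h i
    simp only [List.flatMap_nil, sub_nil, untag, List.map_eq_nil_iff] at this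
    simp [this]
  | cons o σ ih =>
    obtain ⟨i, ⟨⟩, m, a, b⟩ := o
    have hi := h i
    have hci := hc i
    simp only [List.flatMap_cons, sub_append, sub_cons, Event.pid, if_true, sub_nil] at hi
    obtain ⟨t, q, hq, hqp, hqi⟩ : ∃ t q, c i = .call i m a t :: .ret i m b t :: q ∧ Paired q ∧
        untag q = sub i (σ.flatMap (fun o =>
          [.call o.1 o.2.2.method o.2.2.arg o.2.1, .ret o.1 o.2.2.method o.2.2.res o.2.1])) := by
      generalize c i = ci at hi hci
      cases hci with
      | nil => simp at hi
      | cons i' m' a' b' t q =>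
        simp only [untag_cons, Event.untag, List.cons_append, List.nil_append, List.cons.injEq,
          Event.call.injEq, Event.ret.injEq] at hi
        obtain ⟨⟨rfl, rfl, rfl, -⟩, ⟨-, -, rfl, -⟩, hi⟩ := hi
        exact ⟨t, _, rfl, q, hi⟩
    obtain ⟨τ, h1, h2, h3⟩ := ih (Function.update c i q) (fun j => by
        by_cases hj : j = i
        · subst hj; simpa using hqp
        · simpa [hj] using hc j) (fun j => by
        by_cases hj : j = i
        · subst hj; simpa using hqi
        · have := h j
          simp only [List.flatMap_cons, sub_append, sub_cons, Event.pid, sub_nil,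
            Ne.symm hj, if_false, List.nil_append] at this
          simpa [hj] using this)
    refine ⟨(i, t, ⟨m, a, b⟩) :: τ, by simp [h1], ?_, fun j => ?_⟩
    · rw [List.flatMap_cons, untag_append, h2]; rfl
    · rw [List.flatMap_cons, sub_append, h3]
      by_cases hj : j = i
      · subst hj; simp [sub_cons, Event.pid, hq]
      · simp [sub_cons, Event.pid, Ne.symm hj, hj]

/-- A linearization of the untagged history lifts to the tagged history. -/
theorem Linearizable.of_untag {Spec : Set (List (Operation M A B))} {h : List (Event n M A B T)}
    (hh : IsHistory h) (H : Linearizable Spec (untag h)) : Linearizable Spec h := by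
  obtain ⟨s, hs⟩ := H
  obtain ⟨⟨σ, hσ, rfl⟩, h2, h3⟩ := isLinearization_iff.1 hs
  choose c hc1 hc2 using fun i =>
    Completion.exists_tagged (hh i) (by have := h2 i; rwa [sub_untag] at this)
  obtain ⟨τ, t1, t2, t3⟩ := exists_tagged_of_sub σ c (fun i => (hc1 i).paired) hc2
  refine ⟨_, isLinearization_iff.2 ⟨⟨τ, by rwa [t1], rfl⟩, fun i => by rw [t3]; exact hc1 i, ?_⟩⟩
  intro i k j l hb hl
  rw [← happensBefore_untag, t2]
  refine h3 i k j l (happensBefore_untag.2 hb) ?_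
  rwa [← t2, numCalls_untag]

/-! ### Identities of operations -/

/-- The tags of the call actions. -/
def callTags (h : List (Event n M A B T)) : List T :=
  h.filterMap fun
    | .call _ _ _ t => some t
    | .ret _ _ _ _ => none

@[simp] lemma callTags_append (h h' : List (Event n M A B T)) :
    callTags (h ++ h') = callTags h ++ callTags h' := List.filterMap_append

lemma mem_callTags {h : List (Event n M A B T)} {t : T} :
    t ∈ callTags h ↔ ∃ i m a, Event.call i m a t ∈ h := by
  simp only [callTags, List.mem_filterMap]
  constructor
  · rintro ⟨e, he, h⟩
    cases e with
    | call i m a t' => obtain rfl : t' = t := by simpa using h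
                       exact ⟨i, m, a, he⟩
    | ret => simp at h
  · rintro ⟨i, m, a, he⟩
    exact ⟨_, he, rfl⟩

lemma callTags_sublist_sub (i : Fin n) (h : List (Event n M A B T)) :
    (callTags (sub i h)).Sublist (callTags h) := List.filter_sublist.filterMap _

lemma call_eq_of_callTags_nodup {h : List (Event n M A B T)} (hd : (callTags h).Nodup)
    {i i' : Fin n} {m m' : M} {a a' : A} {t : T} (h1 : Event.call i m a t ∈ h)
    (h2 : Event.call i' m' a' t ∈ h) : i = i' ∧ m = m' := by
  induction h with
  | nil => simp at h1
  | cons e h ih =>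
    have hsplit : callTags (e :: h) = callTags [e] ++ callTags h := by
      rw [← callTags_append]; rfl
    rw [hsplit, List.nodup_append] at hd
    rcases List.mem_cons.1 h1 with rfl | h1' <;> rcases List.mem_cons.1 h2 with h2' | h2'
    · cases h2'; exact ⟨rfl, rfl⟩
    · exact (hd.2.2 t (by simp [callTags]) t (mem_callTags.2 ⟨_, _, _, h2'⟩) rfl).elim
    · subst h2'
      exact (hd.2.2 t (by simp [callTags]) t (mem_callTags.2 ⟨_, _, _, h1'⟩) rfl).elim
    · exact ih hd.2.1 h1' h2'

lemma Paired.ret_unique {p : List (Event n M A B T)} (hp : Paired p) (hd : (callTags p).Nodup)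
    {i i' : Fin n} {m m' : M} {b b' : B} {t : T} (h1 : Event.ret i m b t ∈ p)
    (h2 : Event.ret i' m' b' t ∈ p) : b = b' := by
  induction hp with
  | nil => simp at h1
  | @cons j k a c t' p hp ih =>
    obtain ⟨hd1, hd2⟩ : t' ∉ callTags p ∧ (callTags p).Nodup := List.nodup_cons.1 hd
    have key : ∀ {i m b}, Event.ret i m b t' ∉ p := fun h => by
      obtain ⟨a, ha⟩ := hp.exists_call h
      exact hd1 (mem_callTags.2 ⟨_, _, _, ha⟩)
    simp only [List.mem_cons, reduceCtorEq, false_or, Event.ret.injEq] at h1 h2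
    rcases h1 with ⟨-, -, rfl, rfl⟩ | h1 <;> rcases h2 with ⟨-, -, rfl, h2⟩ | h2
    · rfl
    · exact (key h2).elim
    · subst h2; exact (key h1).elim
    · exact ih hd2 h1 h2

lemma Completion.callTags_sublist {p c : List (Event n M A B T)} (h : Completion p c) :
    (callTags c).Sublist (callTags p) := by
  induction h with
  | nil => exact .refl _
  | drop => exact List.nil_sublist _
  | finish => exact .refl _
  | cons _ _ _ _ _ _ ih => exact ih.cons_cons _

/-- In a linearization of a history with distinct operation identities, every operation has only
one return value. -/
lemma IsLinearization.ret_unique {Spec : Set (List (Operation M A B))}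
    {h s : List (Event n M A B T)} (hs : IsLinearization Spec h s) (hd : (callTags h).Nodup)
    {i i' : Fin n} {m m' : M} {b b' : B} {t : T} (h1 : Event.ret i m b t ∈ s)
    (h2 : Event.ret i' m' b' t ∈ s) : b = b' := by
  obtain ⟨-, hc, -⟩ := isLinearization_iff.1 hs
  have h1 := mem_sub.2 ⟨h1, rfl⟩
  have h2 := mem_sub.2 ⟨h2, rfl⟩
  simp only [Event.pid] at h1 h2
  obtain ⟨a, ha⟩ := (hc i).paired.exists_call h1
  obtain ⟨a', ha'⟩ := (hc i').paired.exists_call h2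
  obtain ⟨rfl, -⟩ := call_eq_of_callTags_nodup hd (mem_sub.1 ((hc i).call_mem ha)).1
    (mem_sub.1 ((hc i').call_mem ha')).1
  exact (hc i).paired.ret_unique
    (hd.sublist ((hc i).callTags_sublist.trans (callTags_sublist_sub i h))) h1 h2

/-- A completion of a prefix that contains all returns of the longer list is a completion of the
longer list. -/
lemma Completion.of_prefix {p q c : List (Event n M A B T)} (hp : ∃ d, Completion p d)
    (h : Completion q c) (hq : q <+: p) (hd : (callTags p).Nodup)
    (hret : ∀ i m b t, Event.ret i m b t ∈ p → Event.ret i m b t ∈ c) : Completion p c := by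
  obtain ⟨d, hp⟩ := hp
  induction hp generalizing q c with
  | nil => obtain rfl := List.prefix_nil.1 hq; exact h
  | drop i m a t =>
    rcases List.prefix_cons_iff.1 hq with rfl | ⟨q, rfl, hq'⟩
    · cases h; exact .drop _ _ _ _
    · obtain rfl := List.prefix_nil.1 hq'; exact h
  | finish i m a b t =>
    rcases List.prefix_cons_iff.1 hq with rfl | ⟨q, rfl, hq'⟩
    · cases h; exact .drop _ _ _ _
    · obtain rfl := List.prefix_nil.1 hq'; exact h
  | @cons i m a b t p d hpd ih =>
    obtain ⟨hd1, hd2⟩ : t ∉ callTags p ∧ (callTags p).Nodup := List.nodup_cons.1 hd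
    have key : ∀ {i m b}, Event.ret i m b t ∉ p := fun h => by
      obtain ⟨a, ha⟩ := hpd.paired.exists_call (hpd.ret_mem h)
      exact hd1 (mem_callTags.2 ⟨_, _, _, hpd.call_mem ha⟩)
    have hb := hret i m b t (by simp)
    rcases List.prefix_cons_iff.1 hq with rfl | ⟨q, rfl, hq'⟩
    · cases h; simp at hb
    rcases List.prefix_cons_iff.1 hq' with rfl | ⟨q, rfl, hq''⟩
    · cases h with
      | drop => simp at hb
      | finish _ _ _ b' =>
        obtain rfl : b = b' := by simpa using hb
        refine .cons _ _ _ _ _ ?_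
        cases hpd with
        | nil => exact .nil
        | drop => exact .drop _ _ _ _
        | finish => exact .drop _ _ _ _
        | cons i' m' a' b' t' =>
          have := hret i' m' b' t' (by simp)
          simp only [List.mem_cons, reduceCtorEq, Event.ret.injEq, false_or, List.not_mem_nil,
            or_false] at this
          obtain ⟨-, -, -, rfl⟩ := this
          exact (key (by simp : Event.ret i' m' b' t' ∈ _)).elim
    · cases h with
      | cons _ _ _ _ _ h =>
        refine .cons _ _ _ _ _ (ih h hq'' hd2 fun i' m' b' t' h' => ?_)
        have := hret i' m' b' t' (by simp [h'])
        simp only [List.mem_cons, reduceCtorEq, Event.ret.injEq, false_or] at this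
        rcases this with ⟨-, -, -, rfl⟩ | this
        · exact (key h').elim
        · exact this

end History

namespace Universal

/-! ### The list of decided nodes -/

variable {n : ℕ} {M A B : Type*} {Spec : Set (List (Operation M A B))}

/-- The `lin` field of the node of operation `o` gives it the return value `b`. -/
def Val (g : Shared n M A B) (o : ℕ) (b : B) : Prop :=
  ∃ l, (g.node (some o)).lin = some l ∧ HasRet l o b

/-- All that is required of the linearization `l` stored in the `lin` field of the node `r`: it
linearizes a prefix of the recorded history, contains the operation of `r`, and agrees with the
return values fixed by the nodes decided before `r`. Here `pos` gives the positions of the decided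
nodes, see `Inv`. -/
structure GoodLin (Spec : Set (List (Operation M A B))) (g : Shared n M A B) (pos : Ref → ℕ)
    (r : Ref) (l : Hist n M A B) : Prop where
  two_le : 2 ≤ pos r
  linearizes : ∃ h, h <+: g.recorder ∧ IsLinearization Spec h l
  own : ∃ o b, r = some o ∧ HasRet l o b
  earlier : ∀ o, pos (some o) ≠ 0 → pos (some o) < pos r →
    ∃ l₀ b, (g.node (some o)).lin = some l₀ ∧ HasRet l₀ o b ∧ HasRet l o b

/-- The invariant of the shared memory. The ghost function `pos` gives the position of a node in
the chain that starts with the sentinel and follows the outcomes of the consensus objects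
`decideNext`; it is `0` for the nodes outside of this chain. -/
structure Inv (Spec : Set (List (Operation M A B))) (g : Shared n M A B) (pos : Ref → ℕ) :
    Prop where
  pos_none : pos none = 1
  pos_inj : ∀ r r', pos r ≠ 0 → pos r = pos r' → r = r'
  bounded : ∃ K, ∀ r, pos r ≤ K
  decided : ∀ r r', (g.node r).decideNext = some r' → (g.node r).seq ≠ 0 ∧ pos r' = pos r + 1
  pred : ∀ r, 2 ≤ pos r → ∃ r₀, pos r₀ + 1 = pos r ∧ (g.node r₀).decideNext = some r
  seq_none : (g.node none).seq ≠ 0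
  seq_eq : ∀ r, (g.node r).seq ≠ 0 → (g.node r).seq = pos r
  threaded : ∀ r r', (g.node r).decideNext = some r' → (g.node r').seq ≠ 0 →
    (g.node r).next = some r'
  next : ∀ r r', (g.node r).next = some r' →
    (g.node r).decideNext = some r' ∧ (g.node r').lin ≠ none
  raw : ∀ o, (g.node (some o)).inv = none → g.node (some o) = newNode none ∧ pos (some o) = 0
  lin : ∀ r l, (g.node r).lin = some l → GoodLin Spec g pos r l
  hist : ∀ r h, (g.node r).hist = some h → h <+: g.recorder
  head : ∀ i, (g.node (g.head i)).seq ≠ 0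
  announce : ∀ i o, g.announce i = some o → (g.node (some o)).inv ≠ none
  ret : ∀ i m b o, Event.ret i m b o ∈ g.recorder → Val g o b

/-- What stays true of the memory when other processes take steps. -/
structure Later (g : Shared n M A B) (pos : Ref → ℕ) (g' : Shared n M A B) (pos' : Ref → ℕ) :
    Prop where
  pos_old : ∀ r, pos r ≠ 0 → pos' r = pos r
  pos_new : ∀ r, pos r = 0 → pos' r ≠ 0 → ∀ r', pos r' < pos' r
  seq : ∀ r, (g.node r).seq ≠ 0 → (g'.node r).seq ≠ 0
  dec : ∀ r r', (g.node r).decideNext = some r' → (g'.node r).decideNext = some r'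
  next : ∀ r r', (g.node r).next = some r' → (g'.node r).next = some r'
  lin : ∀ r l, (g.node r).lin = some l → (g'.node r).lin = some l
  inv : ∀ r, (g.node r).inv ≠ none → (g'.node r).inv ≠ none
  recorder : g.recorder <+: g'.recorder

/-- `r'` is not among the nodes decided up to `r`. -/
def After (pos : Ref → ℕ) (r r' : Ref) : Prop := pos r' = 0 ∨ pos r < pos r'

/-- A reference that other processes may hold. -/
def Published (g : Shared n M A B) (r : Ref) : Prop :=
  ∀ o, r = some o → (g.node (some o)).inv ≠ none

/-- The invariant of the local state of process `i`. -/
def LocInv (Spec : Set (List (Operation M A B))) (g : Shared n M A B) (pos : Ref → ℕ) (i : Fin n) :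
    Local n M A B → Prop
  | .genID _ _ | .storeCall _ _ _ | .announceNode _ _ _ | .getRetValue _ _ | .done _ => True
  | .maxHead _ o | .loopTest _ o => g.announce i = some o
  | .readBefore _ o => g.announce i = some o ∧ After pos (g.head i) (some o)
  | .readHelp _ o r | .preferOwn _ o r =>
      g.announce i = some o ∧ (g.node r).seq ≠ 0 ∧ After pos r (some o)
  | .testHelp _ o r r' =>
      g.announce i = some o ∧ (g.node r).seq ≠ 0 ∧ After pos r (some o) ∧ Published g r'
  | .preferHelp _ o r r' | .decide _ o r r' =>
      g.announce i = some o ∧ (g.node r).seq ≠ 0 ∧ After pos r r' ∧ Published g r'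
  | .readHist _ o r r' | .genLin _ o r r' =>
      g.announce i = some o ∧ (g.node r).decideNext = some r'
  | .casHist _ o r r' h =>
      g.announce i = some o ∧ (g.node r).decideNext = some r' ∧ h <+: g.recorder
  | .casLin _ o r r' l =>
      g.announce i = some o ∧ (g.node r).decideNext = some r' ∧ GoodLin Spec g pos r' l
  | .setNext _ o r r' =>
      g.announce i = some o ∧ (g.node r).decideNext = some r' ∧ (g.node r').lin ≠ none
  | .setSeq _ o r r' =>
      g.announce i = some o ∧ (g.node r).decideNext = some r' ∧ (g.node r).next = some r'
  | .setHead _ o r => g.announce i = some o ∧ (g.node r).seq ≠ 0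
  | .setHeadOwn _ o => g.announce i = some o ∧ (g.node (some o)).seq ≠ 0
  | .storeReturn _ o b => Val g o b

section Monotonicity

variable {g g' : Shared n M A B} {pos pos' : Ref → ℕ}

lemma Later.refl (g : Shared n M A B) (pos : Ref → ℕ) : Later g pos g pos where
  pos_old _ _ := rfl
  pos_new _ h h' := (h' h).elim
  seq _ := id
  dec _ _ := id
  next _ _ := id
  lin _ _ := id
  inv _ := id
  recorder := List.prefix_refl _

lemma Val.later {o : ℕ} {b : B} (h : Val g o b) (L : Later g pos g' pos') : Val g' o b :=
  let ⟨l, h1, h2⟩ := h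
  ⟨l, L.lin _ _ h1, h2⟩

lemma Published.later {r : Ref} (h : Published g r) (L : Later g pos g' pos') : Published g' r :=
  fun o ho => L.inv _ (h o ho)

lemma After.later {r r' : Ref} (h : After pos r r') (hr : pos r ≠ 0) (L : Later g pos g' pos') :
    After pos' r r' := by
  unfold After at *
  rw [L.pos_old r hr]
  by_cases h0 : pos r' = 0
  · by_cases h1 : pos' r' = 0
    · exact .inl h1
    · exact .inr (L.pos_new r' h0 h1 r)
  · rw [L.pos_old r' h0]
    exact .inr (h.resolve_left h0)

lemma GoodLin.later {r : Ref} {l : Hist n M A B} (h : GoodLin Spec g pos r l)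
    (L : Later g pos g' pos') : GoodLin Spec g' pos' r l := by
  obtain ⟨h1, ⟨h0, h2, h3⟩, h4, h5⟩ := h
  have hr : pos' r = pos r := L.pos_old r (by omega)
  refine ⟨by omega, ⟨h0, h2.trans L.recorder, h3⟩, h4, fun o ho hlt => ?_⟩
  by_cases h0 : pos (some o) = 0
  · have := L.pos_new _ h0 ho r
    omega
  · rw [L.pos_old _ h0, hr] at hlt
    obtain ⟨l₀, b, h6, h7⟩ := h5 o h0 hlt
    exact ⟨l₀, b, L.lin _ _ h6, h7⟩

lemma Inv.pos_ne_zero (H : Inv Spec g pos) {r : Ref} (hr : (g.node r).seq ≠ 0) : pos r ≠ 0 := by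
  rwa [← H.seq_eq r hr]

lemma LocInv.later (H : Inv Spec g pos) {i : Fin n} {p : Local n M A B}
    (h : LocInv Spec g pos i p) (L : Later g pos g' pos')
    (hh : g'.head i = g.head i) (ha : g'.announce i = g.announce i) : LocInv Spec g' pos' i p := by
  have hlin : ∀ r, (g.node r).lin ≠ none → (g'.node r).lin ≠ none := fun r hr => by
    obtain ⟨l, hl⟩ := Option.ne_none_iff_exists'.1 hr
    simp [L.lin r l hl]
  cases p <;> simp only [LocInv, ha, hh] at h ⊢
  all_goals first
    | exact h
    | exact ⟨h.1, h.2.later (H.pos_ne_zero (H.head i)) L⟩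
    | exact ⟨h.1, L.seq _ h.2.1, h.2.2.1.later (H.pos_ne_zero h.2.1) L, h.2.2.2.later L⟩
    | exact ⟨h.1, L.seq _ h.2.1, h.2.2.later (H.pos_ne_zero h.2.1) L⟩
    | exact ⟨h.1, L.dec _ _ h.2.1, h.2.2.trans L.recorder⟩
    | exact ⟨h.1, L.dec _ _ h.2.1, h.2.2.later L⟩
    | exact ⟨h.1, L.dec _ _ h.2.1, hlin _ h.2.2⟩
    | exact ⟨h.1, L.dec _ _ h.2.1, L.next _ _ h.2.2⟩
    | exact ⟨h.1, L.dec _ _ h.2⟩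
    | exact ⟨h.1, L.seq _ h.2⟩
    | exact h.later L

/-! ### Consequences of the memory invariant -/

lemma Inv.exists_decided (H : Inv Spec g pos) {r r' : Ref} (hr : pos r ≠ 0)
    (hlt : pos r < pos r') : ∃ x, (g.node r).decideNext = some x := by
  obtain ⟨k, hk⟩ : ∃ k, pos r' = k := ⟨_, rfl⟩
  induction k using Nat.strong_induction_on generalizing r' with
  | _ k ih =>
    obtain ⟨r₀, h1, h2⟩ := H.pred r' (by omega)
    by_cases heq : pos r = pos r₀
    · obtain rfl := H.pos_inj _ _ hr heq
      exact ⟨_, h2⟩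
    · exact ih (pos r₀) (by omega) (by omega) rfl

lemma Inv.seq_ne_zero_of_le (H : Inv Spec g pos) {r r' : Ref} (hr : pos r ≠ 0)
    (hle : pos r ≤ pos r') (hr' : (g.node r').seq ≠ 0) : (g.node r).seq ≠ 0 := by
  rcases hle.eq_or_lt with h | h
  · rwa [H.pos_inj _ _ hr h]
  · obtain ⟨x, hx⟩ := H.exists_decided hr h
    exact (H.decided _ _ hx).1

/-- The `next` pointers lead through all nodes decided before a node whose `seq` is set. -/
lemma Inv.reaches (H : Inv Spec g pos) {r r' : Ref} (hr : pos r ≠ 0)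
    (hle : pos r ≤ pos r') (hr' : (g.node r').seq ≠ 0) : Reaches g r r' := by
  obtain ⟨k, hk⟩ : ∃ k, pos r' = k := ⟨_, rfl⟩
  induction k using Nat.strong_induction_on generalizing r' with
  | _ k ih =>
    by_cases heq : pos r = pos r'
    · rw [H.pos_inj _ _ hr heq]
      exact .refl
    · obtain ⟨r₀, h1, h2⟩ := H.pred r' (by omega)
      exact .tail (ih (pos r₀) (by omega) (by omega) (H.decided _ _ h2).1 rfl)
        (H.threaded _ _ h2 hr')

lemma Inv.goodLin (H : Inv Spec g pos) {r r' : Ref} {l : Hist n M A B}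
    (hd : (g.node r).decideNext = some r') (hl : GenLin Spec g r r' l) :
    GoodLin Spec g pos r' l := by
  obtain ⟨⟨h, h1, h2⟩, h3, h4⟩ := hl
  obtain ⟨hs, hpos⟩ := H.decided _ _ hd
  have hr := H.pos_ne_zero hs
  refine ⟨by omega, ⟨h, H.hist _ _ h1, h2⟩, h3, fun o ho hlt => h4 o ?_ ?_⟩
  · refine H.reaches (by simp [H.pos_none]) (by rw [H.pos_none]; omega) ?_
    exact H.seq_ne_zero_of_le ho (by omega) hs
  · exact H.reaches ho (by omega) hs

/-! ### Preservation of the memory invariant -/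

lemma node_setNode (r r' : Ref) (nd : Node n M A B) :
    (setNode g r nd).node r' = if r' = r then nd else g.node r' := by
  simp [setNode, Function.update_apply]

/-- Overwriting one node leaves a field unchanged that the old and the new value have in common. -/
lemma field_setNode {F : Type*} (f : Node n M A B → F) {r : Ref} {nd : Node n M A B}
    (h : f nd = f (g.node r)) (x : Ref) : f ((setNode g r nd).node x) = f (g.node x) := by
  rw [node_setNode]
  split
  · rename_i hx; rw [hx, h]
  · rfl

lemma Inv.record_call (H : Inv Spec g pos) {i : Fin n} {m : M} {a : A} {o : ℕ} :
    Inv Spec { g with recorder := g.recorder ++ [.call i m a o] } pos ∧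
      Later g pos { g with recorder := g.recorder ++ [.call i m a o] } pos := by
  have L : Later g pos { g with recorder := g.recorder ++ [.call i m a o] } pos :=
    { Later.refl g pos with recorder := List.prefix_append _ _ }
  refine ⟨{ H with lin := ?_, hist := ?_, ret := ?_ }, L⟩
  · exact fun r l hl => (H.lin r l hl).later L
  · exact fun r h hh => (H.hist r h hh).trans L.recorder
  · intro i m b o ho
    simp only [List.mem_append, List.mem_singleton, reduceCtorEq, or_false] at ho
    exact H.ret i m b o ho

lemma Inv.record_ret (H : Inv Spec g pos) {i : Fin n} {m : M} {b : B} {o : ℕ} (hv : Val g o b) :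
    Inv Spec { g with recorder := g.recorder ++ [.ret i m b o] } pos ∧
      Later g pos { g with recorder := g.recorder ++ [.ret i m b o] } pos := by
  have L : Later g pos { g with recorder := g.recorder ++ [.ret i m b o] } pos :=
    { Later.refl g pos with recorder := List.prefix_append _ _ }
  refine ⟨{ H with lin := ?_, hist := ?_, ret := ?_ }, L⟩
  · exact fun r l hl => (H.lin r l hl).later L
  · exact fun r h hh => (H.hist r h hh).trans L.recorder
  · intro i m b o ho
    simp only [List.mem_append, List.mem_singleton, Event.ret.injEq] at ho
    rcases ho with ho | ⟨rfl, rfl, rfl, rfl⟩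
    · exact H.ret i m b o ho
    · exact hv

lemma Inv.write_head (H : Inv Spec g pos) {i : Fin n} {r : Ref} (hr : (g.node r).seq ≠ 0) :
    Inv Spec (Universal.setHead g i r) pos ∧ Later g pos (Universal.setHead g i r) pos := by
  have L : Later g pos (Universal.setHead g i r) pos := { Later.refl g pos with }
  refine ⟨{ H with lin := ?_, head := ?_ }, L⟩
  · exact fun r l hl => (H.lin r l hl).later L
  · intro j
    by_cases hj : j = i
    · subst hj; simpa [Universal.setHead] using hr
    · simpa [Universal.setHead, hj] using H.head j

lemma Inv.announce_node (H : Inv Spec g pos) {i : Fin n} {m : M} {a : A} {o : ℕ}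
    (ho : (g.node (some o)).inv = none) :
    Inv Spec { setNode g (some o) (newNode (some (m, a))) with
      announce := Function.update g.announce i (some o) } pos ∧
    Later g pos { setNode g (some o) (newNode (some (m, a))) with
      announce := Function.update g.announce i (some o) } pos := by
  obtain ⟨hraw, hpos⟩ := H.raw o ho
  set g' : Shared n M A B := { setNode g (some o) (newNode (some (m, a))) with
      announce := Function.update g.announce i (some o) } with hg'
  have hs : ∀ x, (g'.node x).seq = (g.node x).seq :=
    field_setNode Node.seq (by rw [hraw]; rfl)
  have hd : ∀ x, (g'.node x).decideNext = (g.node x).decideNext :=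
    field_setNode Node.decideNext (by rw [hraw]; rfl)
  have hn : ∀ x, (g'.node x).next = (g.node x).next :=
    field_setNode Node.next (by rw [hraw]; rfl)
  have hl : ∀ x, (g'.node x).lin = (g.node x).lin :=
    field_setNode Node.lin (by rw [hraw]; rfl)
  have hh : ∀ x, (g'.node x).hist = (g.node x).hist :=
    field_setNode Node.hist (by rw [hraw]; rfl)
  have hi : ∀ x, (g.node x).inv ≠ none → (g'.node x).inv ≠ none := by
    intro x hx
    by_cases hxo : x = some o
    · subst hxo; exact (hx ho).elim
    · simpa [hg', setNode, hxo] using hx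
  have L : Later g pos g' pos := by
    refine ⟨fun _ _ => rfl, fun _ h h' => (h' h).elim, ?_, ?_, ?_, ?_, hi, List.prefix_refl _⟩
    · simp [hs]
    · simp [hd]
    · simp [hn]
    · simp [hl]
  refine ⟨⟨H.pos_none, H.pos_inj, H.bounded, ?_, ?_, ?_, ?_, ?_, ?_, ?_, ?_, ?_, ?_, ?_, ?_⟩, L⟩
  · simpa only [hs, hd] using H.decided
  · simpa only [hd] using H.pred
  · simpa only [hs] using H.seq_none
  · simpa only [hs] using H.seq_eq
  · simpa only [hs, hd, hn] using H.threaded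
  · simpa only [hn, hd, hl] using H.next
  · intro x hx
    by_cases hxo : x = o
    · subst hxo; simp [hg', setNode, newNode] at hx
    · have : g'.node (some x) = g.node (some x) := by simp [hg', setNode, hxo]
      rw [this] at hx ⊢
      exact H.raw x hx
  · exact fun r l h => (H.lin r l (by rwa [← hl])).later L
  · exact fun r h h' => H.hist r h (by rwa [← hh])
  · intro j; rw [hs]; exact H.head j
  · intro j x hx
    by_cases hj : j = i
    · subst hj
      obtain rfl : o = x := by simpa [hg'] using hx
      simp [hg', setNode, newNode]
    · exact hi _ (H.announce j x (by simpa [hg', hj] using hx))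
  · exact fun i m b o h => (H.ret i m b o h).later L

lemma Inv.raw_setNode (H : Inv Spec g pos) {r : Ref} {nd : Node n M A B} (hr : pos r ≠ 0)
    (hnd : nd.inv = (g.node r).inv) (o : ℕ) (ho : ((setNode g r nd).node (some o)).inv = none) :
    (setNode g r nd).node (some o) = newNode none ∧ pos (some o) = 0 := by
  rw [field_setNode Node.inv hnd] at ho
  have h := H.raw o ho
  have hne : some o ≠ r := by rintro rfl; exact hr h.2
  rw [node_setNode, if_neg hne]
  exact h

lemma Inv.write_hist (H : Inv Spec g pos) {r : Ref} (hr : pos r ≠ 0) {h : Hist n M A B}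
    (hh : h <+: g.recorder) :
    Inv Spec (setNode g r { g.node r with hist := (g.node r).hist.or (some h) }) pos ∧
    Later g pos (setNode g r { g.node r with hist := (g.node r).hist.or (some h) }) pos := by
  set nd : Node n M A B := { g.node r with hist := (g.node r).hist.or (some h) } with hnd
  have hs := field_setNode (g := g) (r := r) (nd := nd) Node.seq rfl
  have hd := field_setNode (g := g) (r := r) (nd := nd) Node.decideNext rfl
  have hn := field_setNode (g := g) (r := r) (nd := nd) Node.next rfl
  have hl := field_setNode (g := g) (r := r) (nd := nd) Node.lin rfl
  have hi := field_setNode (g := g) (r := r) (nd := nd) Node.inv rfl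
  have L : Later g pos (setNode g r nd) pos := by
    refine ⟨fun _ _ => rfl, fun _ h h' => (h' h).elim, ?_, ?_, ?_, ?_, ?_, List.prefix_refl _⟩
    · simp [hs]
    · simp [hd]
    · simp [hn]
    · simp [hl]
    · simp [hi]
  refine ⟨⟨H.pos_none, H.pos_inj, H.bounded, ?_, ?_, ?_, ?_, ?_, ?_, H.raw_setNode hr rfl, ?_, ?_,
    ?_, ?_, ?_⟩, L⟩
  · simpa only [hs, hd] using H.decided
  · simpa only [hd] using H.pred
  · simpa only [hs] using H.seq_none
  · simpa only [hs] using H.seq_eq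
  · simpa only [hs, hd, hn] using H.threaded
  · simpa only [hn, hd, hl] using H.next
  · exact fun x l h => (H.lin x l (by rwa [← hl])).later L
  · intro x h' hx
    rw [node_setNode] at hx
    split at hx
    · simp only [hnd, Option.or_eq_some_iff] at hx
      rcases hx with hx | ⟨-, hx⟩
      · exact H.hist _ _ hx
      · obtain rfl : h = h' := by simpa using hx
        exact hh
    · exact H.hist _ _ hx
  · intro j; rw [hs]; exact H.head j
  · intro j x hx; rw [hi]; exact H.announce j x hx
  · exact fun i m b o h => (H.ret i m b o h).later L

lemma Inv.write_lin (H : Inv Spec g pos) {r : Ref} {l : Hist n M A B}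
    (hl : GoodLin Spec g pos r l) :
    Inv Spec (setNode g r { g.node r with lin := (g.node r).lin.or (some l) }) pos ∧
    Later g pos (setNode g r { g.node r with lin := (g.node r).lin.or (some l) }) pos := by
  have hr : pos r ≠ 0 := by have := hl.two_le; omega
  set nd : Node n M A B := { g.node r with lin := (g.node r).lin.or (some l) } with hnd
  have hs := field_setNode (g := g) (r := r) (nd := nd) Node.seq rfl
  have hd := field_setNode (g := g) (r := r) (nd := nd) Node.decideNext rfl
  have hn := field_setNode (g := g) (r := r) (nd := nd) Node.next rfl
  have hh := field_setNode (g := g) (r := r) (nd := nd) Node.hist rfl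
  have hi := field_setNode (g := g) (r := r) (nd := nd) Node.inv rfl
  have hold : ∀ x l', (g.node x).lin = some l' → ((setNode g r nd).node x).lin = some l' := by
    intro x l' h
    rw [node_setNode]
    split
    · rename_i hx; subst hx; simp [hnd, h]
    · exact h
  have L : Later g pos (setNode g r nd) pos := by
    refine ⟨fun _ _ => rfl, fun _ h h' => (h' h).elim, ?_, ?_, ?_, hold, ?_, List.prefix_refl _⟩
    · simp [hs]
    · simp [hd]
    · simp [hn]
    · simp [hi]
  refine ⟨⟨H.pos_none, H.pos_inj, H.bounded, ?_, ?_, ?_, ?_, ?_, ?_, H.raw_setNode hr rfl, ?_, ?_,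
    ?_, ?_, ?_⟩, L⟩
  · simpa only [hs, hd] using H.decided
  · simpa only [hd] using H.pred
  · simpa only [hs] using H.seq_none
  · simpa only [hs] using H.seq_eq
  · simpa only [hs, hd, hn] using H.threaded
  · intro x y hxy
    rw [hn] at hxy
    obtain ⟨h1, h2⟩ := H.next x y hxy
    obtain ⟨l', hl'⟩ := Option.ne_none_iff_exists'.1 h2
    exact ⟨by rwa [hd], by simp [hold y l' hl']⟩
  · intro x l' hx
    rw [node_setNode] at hx
    split at hx
    · rename_i hxr
      subst hxr
      simp only [hnd, Option.or_eq_some_iff] at hx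
      rcases hx with hx | ⟨-, hx⟩
      · exact (H.lin _ _ hx).later L
      · obtain rfl : l = l' := by simpa using hx
        exact hl.later L
    · exact (H.lin _ _ hx).later L
  · exact fun x h h' => H.hist x h (by rwa [← hh])
  · intro j; rw [hs]; exact H.head j
  · intro j x hx; rw [hi]; exact H.announce j x hx
  · exact fun i m b o h => (H.ret i m b o h).later L

lemma Inv.write_next (H : Inv Spec g pos) {r r' : Ref} (hd' : (g.node r).decideNext = some r')
    (hl' : (g.node r').lin ≠ none) :
    Inv Spec (setNode g r { g.node r with next := some r' }) pos ∧
    Later g pos (setNode g r { g.node r with next := some r' }) pos := by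
  have hr : pos r ≠ 0 := H.pos_ne_zero (H.decided _ _ hd').1
  set nd : Node n M A B := { g.node r with next := some r' } with hnd
  have hs := field_setNode (g := g) (r := r) (nd := nd) Node.seq rfl
  have hd := field_setNode (g := g) (r := r) (nd := nd) Node.decideNext rfl
  have hl := field_setNode (g := g) (r := r) (nd := nd) Node.lin rfl
  have hh := field_setNode (g := g) (r := r) (nd := nd) Node.hist rfl
  have hi := field_setNode (g := g) (r := r) (nd := nd) Node.inv rfl
  have hold : ∀ x y, (g.node x).next = some y → ((setNode g r nd).node x).next = some y := by
    intro x y h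
    rw [node_setNode]
    split
    · rename_i hx
      subst hx
      rw [hnd, ← hd', (H.next _ _ h).1]
    · exact h
  have L : Later g pos (setNode g r nd) pos := by
    refine ⟨fun _ _ => rfl, fun _ h h' => (h' h).elim, ?_, ?_, hold, ?_, ?_, List.prefix_refl _⟩
    · simp [hs]
    · simp [hd]
    · simp [hl]
    · simp [hi]
  refine ⟨⟨H.pos_none, H.pos_inj, H.bounded, ?_, ?_, ?_, ?_, ?_, ?_, H.raw_setNode hr rfl, ?_, ?_,
    ?_, ?_, ?_⟩, L⟩
  · simpa only [hs, hd] using H.decided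
  · simpa only [hd] using H.pred
  · simpa only [hs] using H.seq_none
  · simpa only [hs] using H.seq_eq
  · intro x y h1 h2
    rw [hd] at h1
    rw [hs] at h2
    exact hold x y (H.threaded x y h1 h2)
  · intro x y hxy
    rw [hd, hl]
    rw [node_setNode] at hxy
    split at hxy
    · rename_i hx
      subst hx
      obtain rfl : r' = y := by simpa [hnd] using hxy
      exact ⟨hd', hl'⟩
    · exact H.next x y hxy
  · exact fun x l h => (H.lin x l (by rwa [← hl])).later L
  · exact fun x h h' => H.hist x h (by rwa [← hh])
  · intro j; rw [hs]; exact H.head j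
  · intro j x hx; rw [hi]; exact H.announce j x hx
  · exact fun i m b o h => (H.ret i m b o h).later L

lemma Inv.write_seq (H : Inv Spec g pos) {r r' : Ref} (hd' : (g.node r).decideNext = some r')
    (hn' : (g.node r).next = some r') :
    Inv Spec (setNode g r' { g.node r' with seq := (g.node r).seq + 1 }) pos ∧
    Later g pos (setNode g r' { g.node r' with seq := (g.node r).seq + 1 }) pos := by
  obtain ⟨hsr, hpr⟩ := H.decided _ _ hd'
  have hr : pos r ≠ 0 := H.pos_ne_zero hsr
  set nd : Node n M A B := { g.node r' with seq := (g.node r).seq + 1 } with hnd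
  have hd := field_setNode (g := g) (r := r') (nd := nd) Node.decideNext rfl
  have hn := field_setNode (g := g) (r := r') (nd := nd) Node.next rfl
  have hl := field_setNode (g := g) (r := r') (nd := nd) Node.lin rfl
  have hh := field_setNode (g := g) (r := r') (nd := nd) Node.hist rfl
  have hi := field_setNode (g := g) (r := r') (nd := nd) Node.inv rfl
  have hold : ∀ x, (g.node x).seq ≠ 0 → ((setNode g r' nd).node x).seq ≠ 0 := by
    intro x h
    rw [node_setNode]
    split
    · simp [hnd]
    · exact h
  have L : Later g pos (setNode g r' nd) pos := by
    refine ⟨fun _ _ => rfl, fun _ h h' => (h' h).elim, hold, ?_, ?_, ?_, ?_, List.prefix_refl _⟩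
    · simp [hd]
    · simp [hn]
    · simp [hl]
    · simp [hi]
  refine ⟨⟨H.pos_none, H.pos_inj, H.bounded, ?_, ?_, ?_, ?_, ?_, ?_,
    H.raw_setNode (by omega) rfl, ?_, ?_, ?_, ?_, ?_⟩, L⟩
  · intro x y h
    rw [hd] at h
    exact ⟨hold x (H.decided x y h).1, (H.decided x y h).2⟩
  · simpa only [hd] using H.pred
  · exact hold _ H.seq_none
  · intro x h
    rw [node_setNode] at h ⊢
    split
    · rename_i hx
      subst hx
      simp only [hnd]
      rw [H.seq_eq r hsr, hpr]
    · rename_i hx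
      rw [if_neg hx] at h
      exact H.seq_eq x h
  · intro x y h1 h2
    rw [hd] at h1
    rw [hn]
    by_cases hy : y = r'
    · subst hy
      obtain ⟨h3, h4⟩ := H.decided x y h1
      obtain rfl := H.pos_inj r x hr (by omega)
      exact hn'
    · rw [node_setNode, if_neg hy] at h2
      exact H.threaded x y h1 h2
  · simpa only [hn, hd, hl] using H.next
  · exact fun x l h => (H.lin x l (by rwa [← hl])).later L
  · exact fun x h h' => H.hist x h (by rwa [← hh])
  · intro j; exact hold _ (H.head j)
  · intro j x hx; rw [hi]; exact H.announce j x hx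
  · exact fun i m b o h => (H.ret i m b o h).later L

/-- A new outcome of a consensus object puts the proposed node at the end of the chain. The
proposal is not in the chain: it is not among the nodes decided up to `r`, and `r` is the last
decided node because its consensus object is still unused. -/
lemma Inv.decide_new (H : Inv Spec g pos) {r r' : Ref} (hd' : (g.node r).decideNext = none)
    (hs' : (g.node r).seq ≠ 0) (ha : After pos r r') (hp : Published g r') :
    Inv Spec (setNode g r { g.node r with decideNext := some r' })
      (Function.update pos r' (pos r + 1)) ∧
    Later g pos (setNode g r { g.node r with decideNext := some r' })
      (Function.update pos r' (pos r + 1)) := by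
  have hr : pos r ≠ 0 := H.pos_ne_zero hs'
  have hmax : ∀ x, pos x ≤ pos r := by
    intro x
    by_contra hx
    obtain ⟨y, hy⟩ := H.exists_decided hr (not_le.1 hx)
    simp [hd'] at hy
  have hr' : pos r' = 0 := ha.resolve_right (not_lt.2 (hmax r'))
  have hposr : Function.update pos r' (pos r + 1) r' = pos r + 1 := by simp
  have hposx : ∀ x, x ≠ r' → Function.update pos r' (pos r + 1) x = pos x := fun x hx => by
    simp [hx]
  generalize Function.update pos r' (pos r + 1) = pos' at hposr hposx ⊢
  set nd : Node n M A B := { g.node r with decideNext := some r' } with hnd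
  have hs := field_setNode (g := g) (r := r) (nd := nd) Node.seq rfl
  have hn := field_setNode (g := g) (r := r) (nd := nd) Node.next rfl
  have hl := field_setNode (g := g) (r := r) (nd := nd) Node.lin rfl
  have hh := field_setNode (g := g) (r := r) (nd := nd) Node.hist rfl
  have hi := field_setNode (g := g) (r := r) (nd := nd) Node.inv rfl
  have hne : ∀ x, pos x ≠ 0 → x ≠ r' := by rintro x h rfl; exact h hr'
  have hold : ∀ x y, (g.node x).decideNext = some y →
      ((setNode g r nd).node x).decideNext = some y := by
    intro x y h
    rw [node_setNode]
    split
    · rename_i hx; subst hx; simp [hd'] at h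
    · exact h
  have hdec : ∀ x y, ((setNode g r nd).node x).decideNext = some y →
      x = r ∧ y = r' ∨ (g.node x).decideNext = some y := by
    intro x y h
    rw [node_setNode] at h
    split at h
    · rename_i hx
      exact .inl ⟨hx, by simpa [hnd] using h.symm⟩
    · exact .inr h
  have L : Later g pos (setNode g r nd) pos' := by
    refine ⟨fun x hx => hposx x (hne x hx), ?_, ?_, hold, ?_, ?_, ?_, List.prefix_refl _⟩
    · intro x hx hx' y
      by_cases h : x = r'
      · subst h; rw [hposr]; have := hmax y; omega
      · rw [hposx x h] at hx'; exact (hx' hx).elim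
    · simp [hs]
    · simp [hn]
    · simp [hl]
    · simp [hi]
  refine ⟨⟨?_, ?_, ⟨pos r + 1, ?_⟩, ?_, ?_, ?_, ?_, ?_, ?_, ?_, ?_, ?_, ?_, ?_, ?_⟩, L⟩
  · rw [hposx _ (hne _ (by simp [H.pos_none])), H.pos_none]
  · intro x y hx hxy
    by_cases h1 : x = r' <;> by_cases h2 : y = r'
    · rw [h1, h2]
    · rw [h1, hposr, hposx y h2] at hxy; have := hmax y; omega
    · rw [h2, hposr, hposx x h1] at hxy; have := hmax x; omega
    · rw [hposx x h1] at hx hxy; rw [hposx y h2] at hxy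
      exact H.pos_inj x y hx hxy
  · intro x
    by_cases h : x = r'
    · rw [h, hposr]
    · rw [hposx x h]; have := hmax x; omega
  · intro x y hxy
    rw [hs]
    rcases hdec x y hxy with ⟨rfl, rfl⟩ | h
    · exact ⟨hs', by rw [hposr, hposx x (hne x hr)]⟩
    · obtain ⟨h1, h2⟩ := H.decided x y h
      exact ⟨h1, by rw [hposx x (hne x (H.pos_ne_zero h1)), hposx y (hne y (by omega)), h2]⟩
  · intro x hx
    by_cases h : x = r'
    · subst h
      exact ⟨r, by rw [hposr, hposx r (hne r hr)], by rw [node_setNode, if_pos rfl]⟩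
    · rw [hposx x h] at hx ⊢
      obtain ⟨y, h1, h2⟩ := H.pred x hx
      exact ⟨y, by rw [hposx y (hne y (by omega)), h1], hold _ _ h2⟩
  · rw [hs]; exact H.seq_none
  · intro x hx
    rw [hs] at hx ⊢
    rw [hposx x (hne x (H.pos_ne_zero hx))]
    exact H.seq_eq x hx
  · intro x y hxy hy
    rw [hs] at hy
    rw [hn]
    rcases hdec x y hxy with ⟨rfl, rfl⟩ | h
    · exact (H.pos_ne_zero hy hr').elim
    · exact H.threaded x y h hy
  · intro x y hxy
    rw [hn] at hxy
    rw [hl]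
    exact ⟨hold _ _ (H.next x y hxy).1, (H.next x y hxy).2⟩
  · intro o ho
    have h := H.raw_setNode hr (nd := nd) rfl o ho
    refine ⟨h.1, ?_⟩
    rw [hposx, h.2]
    rintro rfl
    rw [hi] at ho
    exact hp o rfl ho
  · exact fun x l h => (H.lin x l (by rwa [← hl])).later L
  · exact fun x h h' => H.hist x h (by rwa [← hh])
  · intro j; rw [hs]; exact H.head j
  · intro j x hx; rw [hi]; exact H.announce j x hx
  · exact fun i m b o h => (H.ret i m b o h).later L

/-- Every atomic command preserves the invariant of the memory and that of its process. -/
theorem Inv.step (H : Inv Spec g pos) {i : Fin n} {p p' : Local n M A B}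
    (hp : LocInv Spec g pos i p)
    (hf : ∀ m a o, p = .announceNode m a o → (g.node (some o)).inv = none)
    (hs : Step Spec i (p, g) (p', g')) :
    ∃ pos', Inv Spec g' pos' ∧ LocInv Spec g' pos' i p' ∧ Later g pos g' pos' ∧
      ∀ j, j ≠ i → g'.head j = g.head j ∧ g'.announce j = g.announce j := by
  have L := Later.refl g pos
  cases hs with
  | genID _ m a o _ =>
    refine ⟨pos, ⟨H.pos_none, H.pos_inj, H.bounded, H.decided, H.pred, H.seq_none, H.seq_eq,
      H.threaded, H.next, H.raw, ?_, H.hist, H.head, H.announce, H.ret⟩, trivial, { L with },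
      fun _ _ => ⟨rfl, rfl⟩⟩
    exact fun r l hl => (H.lin r l hl).later { L with }
  | storeCall _ m a o =>
    exact ⟨pos, H.record_call.1, trivial, H.record_call.2, fun _ _ => ⟨rfl, rfl⟩⟩
  | announceNode _ m a o =>
    obtain ⟨h1, h2⟩ := H.announce_node (i := i) (m := m) (a := a) (hf m a o rfl)
    exact ⟨pos, h1, by simp [LocInv], h2, fun j hj => ⟨rfl, by simp [hj]⟩⟩
  | maxHead _ m o j _ =>
    obtain ⟨h1, h2⟩ := H.write_head (i := i) (H.head j)
    exact ⟨pos, h1, hp, h2, fun k hk => ⟨by simp [Universal.setHead, hk], rfl⟩⟩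
  | loopEnter _ m o h0 =>
    refine ⟨pos, H, ⟨hp, ?_⟩, L, fun _ _ => ⟨rfl, rfl⟩⟩
    -- a node decided up to `head[i]` would already have its sequence number
    rw [hp] at h0
    by_contra hc
    simp only [After, not_or, not_lt] at hc
    exact H.seq_ne_zero_of_le hc.1 hc.2 (H.head i) h0
  | loopExit _ m o h0 =>
    rw [show g.announce i = some o from hp] at h0
    exact ⟨pos, H, ⟨hp, h0⟩, L, fun _ _ => ⟨rfl, rfl⟩⟩
  | readBefore _ m o =>
    exact ⟨pos, H, ⟨hp.1, H.head i, hp.2⟩, L, fun _ _ => ⟨rfl, rfl⟩⟩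
  | readHelp _ m o r =>
    exact ⟨pos, H, ⟨hp.1, hp.2.1, hp.2.2, fun o ho => H.announce _ o ho⟩, L,
      fun _ _ => ⟨rfl, rfl⟩⟩
  | testHelpZero _ m o r r' h0 =>
    refine ⟨pos, H, ⟨hp.1, hp.2.1, ?_, hp.2.2.2⟩, L, fun _ _ => ⟨rfl, rfl⟩⟩
    by_contra hc
    simp only [After, not_or, not_lt] at hc
    exact H.seq_ne_zero_of_le hc.1 hc.2 hp.2.1 h0
  | testHelpNonzero _ m o r r' _ =>
    exact ⟨pos, H, ⟨hp.1, hp.2.1, hp.2.2.1⟩, L, fun _ _ => ⟨rfl, rfl⟩⟩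
  | preferHelp _ m o r r' =>
    exact ⟨pos, H, hp, L, fun _ _ => ⟨rfl, rfl⟩⟩
  | preferOwn _ m o r =>
    refine ⟨pos, H, ⟨hp.1, hp.2.1, ?_, fun o ho => H.announce _ o ho⟩, L,
      fun _ _ => ⟨rfl, rfl⟩⟩
    rw [hp.1]; exact hp.2.2
  | decide _ m o r r' =>
    cases hd : (g.node r).decideNext with
    | none =>
      obtain ⟨h1, h2⟩ := H.decide_new hd hp.2.1 hp.2.2.1 hp.2.2.2
      exact ⟨_, h1, ⟨hp.1, by simp [node_setNode]⟩, h2, fun _ _ => ⟨rfl, rfl⟩⟩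
    | some x =>
      have hg : setNode g r { g.node r with decideNext := some x } = g := by
        rw [← hd]; simp [setNode]
      simp only [Option.some_or, Option.getD_some, hg]
      exact ⟨pos, H, ⟨hp.1, hd⟩, L, fun _ _ => by simp⟩
  | readHist _ m o r r' =>
    exact ⟨pos, H, ⟨hp.1, hp.2, List.prefix_refl _⟩, L, fun _ _ => ⟨rfl, rfl⟩⟩
  | casHist _ m o r r' h =>
    obtain ⟨h1, h2⟩ := H.decided _ _ hp.2.1
    obtain ⟨h3, h4⟩ := H.write_hist (r := r') (by omega) hp.2.2
    exact ⟨pos, h3, ⟨hp.1, h4.dec _ _ hp.2.1⟩, h4, fun _ _ => ⟨rfl, rfl⟩⟩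
  | genLin _ m o r r' l hl =>
    exact ⟨pos, H, ⟨hp.1, hp.2, H.goodLin hp.2 hl⟩, L, fun _ _ => ⟨rfl, rfl⟩⟩
  | casLin _ m o r r' l =>
    obtain ⟨h3, h4⟩ := H.write_lin hp.2.2
    exact ⟨pos, h3, ⟨hp.1, h4.dec _ _ hp.2.1, by simp [node_setNode]⟩, h4, fun _ _ => ⟨rfl, rfl⟩⟩
  | setNext _ m o r r' =>
    obtain ⟨h3, h4⟩ := H.write_next hp.2.1 hp.2.2
    exact ⟨pos, h3, ⟨hp.1, h4.dec _ _ hp.2.1, by simp [node_setNode]⟩, h4, fun _ _ => ⟨rfl, rfl⟩⟩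
  | setSeq _ m o r r' =>
    obtain ⟨h3, h4⟩ := H.write_seq hp.2.1 hp.2.2
    exact ⟨pos, h3, ⟨hp.1, by simp [node_setNode]⟩, h4, fun _ _ => ⟨rfl, rfl⟩⟩
  | setHead _ m o r =>
    obtain ⟨h1, h2⟩ := H.write_head (i := i) hp.2
    exact ⟨pos, h1, hp.1, h2, fun k hk => ⟨by simp [Universal.setHead, hk], rfl⟩⟩
  | setHeadOwn _ m o =>
    obtain ⟨h1, h2⟩ := H.write_head (i := i) (r := g.announce i) (by rw [hp.1]; exact hp.2)
    exact ⟨pos, h1, trivial, h2, fun k hk => ⟨by simp [Universal.setHead, hk], rfl⟩⟩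
  | getRetValue _ m o l b _ h2 h3 =>
    exact ⟨pos, H, ⟨l, h2, h3⟩, L, fun _ _ => ⟨rfl, rfl⟩⟩
  | storeReturn _ m o b =>
    obtain ⟨h1, h2⟩ := H.record_ret (i := i) (m := m) hp
    exact ⟨pos, h1, trivial, h2, fun _ _ => ⟨rfl, rfl⟩⟩

end Monotonicity

lemma inv_initShared :
    Inv Spec (initShared : Shared n M A B) (fun r => if r = none then 1 else 0) := by
  have hnode : ∀ r, r ≠ none → (initShared : Shared n M A B).node r = newNode none := fun r hr => by
    simp [initShared, hr]
  refine ⟨rfl, ?_, ⟨1, fun r => by split <;> simp⟩, ?_, ?_, by simp [initShared], ?_,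
    ?_, ?_, ?_, ?_, ?_, fun i => by simp [initShared], ?_, ?_⟩
  · intro r r' h1 h2
    by_cases h : r = none <;> by_cases h' : r' = none <;> simp_all
  · intro r r' h
    by_cases hr : r = none <;> simp [initShared, hr, newNode] at h
  · intro r h
    by_cases hr : r = none <;> simp [hr] at h
  · intro r h
    by_cases hr : r = none <;> simp [initShared, hr, newNode] at h ⊢
  · intro r r' h
    by_cases hr : r = none <;> simp [initShared, hr, newNode] at h
  · intro r r' h
    by_cases hr : r = none <;> simp [initShared, hr, newNode] at h
  · intro o _
    exact ⟨hnode _ (by simp), by simp⟩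
  · intro r l h
    by_cases hr : r = none <;> simp [initShared, hr, newNode] at h
  · intro r l h
    by_cases hr : r = none <;> simp [initShared, hr, newNode] at h
  · intro i o h
    simp [initShared] at h
  · intro i m b o h
    simp [initShared] at h

end Universal

/-! ### Paths and their histories -/

section Paths

variable {n : ℕ} {M A B C C' : Type*}

lemma LTS.Path.append {Label : Type*} {S : LTS Label} {p q r : S.State} {l l' : List Label}
    (h : S.Path p l q) (h' : S.Path q l' r) : S.Path p (l ++ l') r := by
  induction h with
  | nil => exact h'
  | cons ht _ ih => exact .cons ht (ih h')

lemma history_append (l l' : List (Action n M A B C)) :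
    history (l ++ l') = history l ++ history l' := List.filterMap_append

lemma history_cons (α : Action n M A B C) (l : List (Action n M A B C)) :
    history (α :: l) = history [α] ++ history l := history_append [α] l

lemma ForwardSimulated.exists_path {S₁ : LTS (Action n M A B C)} {S₂ : LTS (Action n M A B C')}
    (H : ForwardSimulated S₁ S₂) {e : List (Action n M A B C)} (he : e ∈ S₁.traces) :
    ∃ e' ∈ S₂.traces, history e' = history e := by
  obtain ⟨R, h0, hstep⟩ := H
  obtain ⟨q, hq⟩ := he
  suffices ∀ p l q, S₁.Path p l q → ∀ p', R p p' →
      ∃ l' q', S₂.Path p' l' q' ∧ history l' = history l by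
    obtain ⟨l', q', h1, h2⟩ := this _ _ _ hq _ h0
    exact ⟨l', ⟨q', h1⟩, h2⟩
  intro p l q h
  induction h with
  | nil => exact fun p' _ => ⟨[], p', .nil _, rfl⟩
  | cons ht _ ih =>
    intro p' hp'
    obtain ⟨l₁, q₁, h1, h2, h3⟩ := hstep _ _ hp' _ _ ht
    obtain ⟨l₂, q₂, h4, h5⟩ := ih _ h3
    exact ⟨_, _, h1.append h4, by rw [history_append, h2, h5, ← history_cons]⟩

end Paths

namespace Universal

variable {n : ℕ} {M A B : Type*} {Spec : Set (List (Operation M A B))}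

/-! ### Operation identities in the universal construction -/

/-- The identity held by a process whose node has not been announced yet. -/
def Local.fresh : Local n M A B → Option ℕ
  | .storeCall _ _ o | .announceNode _ _ o => some o
  | _ => none

/-- Operation identities are unique. -/
structure OidInv (g : Shared n M A B) (π : Fin n → Option (M × Local n M A B)) : Prop where
  fresh : ∀ i m p o, π i = some (m, p) → p.fresh = some o →
    o ∈ g.used ∧ (g.node (some o)).inv = none
  fresh_inj : ∀ i j m m' p p' o, π i = some (m, p) → π j = some (m', p') →
    p.fresh = some o → p'.fresh = some o → i = j
  unrecorded : ∀ i k m a o, π i = some (k, .storeCall m a o) → o ∉ callTags g.recorder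
  recorded_used : ∀ o ∈ callTags g.recorder, o ∈ g.used
  inv_used : ∀ o, (g.node (some o)).inv ≠ none → o ∈ g.used
  nodup : (callTags g.recorder).Nodup

variable {g g' : Shared n M A B} {π : Fin n → Option (M × Local n M A B)}

lemma OidInv.update_of_not_fresh (H : OidInv g π) {i : Fin n} {x : Option (M × Local n M A B)}
    (hx : ∀ m p, x = some (m, p) → p.fresh = none) (hu : g'.used = g.used)
    (hi : ∀ o, (g'.node (some o)).inv = (g.node (some o)).inv)
    (ht : callTags g'.recorder = callTags g.recorder) :
    OidInv g' (Function.update π i x) := by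
  have key : ∀ {j m p o}, Function.update π i x j = some (m, p) → p.fresh = some o →
      π j = some (m, p) := by
    intro j m p o h1 h2
    by_cases hj : j = i
    · subst hj
      have := hx m p (by simpa using h1)
      simp [this] at h2
    · simpa [hj] using h1
  refine ⟨?_, ?_, ?_, ?_, ?_, ?_⟩
  · intro j m p o h1 h2
    rw [hu, hi]
    exact H.fresh j m p o (key h1 h2) h2
  · intro j k m m' p p' o h1 h2 h3 h4
    exact H.fresh_inj j k m m' p p' o (key h1 h3) (key h2 h4) h3 h4
  · intro j k m a o h
    rw [ht]
    exact H.unrecorded j k m a o (key h rfl)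
  · rw [ht, hu]; exact H.recorded_used
  · intro o; rw [hi, hu]; exact H.inv_used o
  · rw [ht]; exact H.nodup

lemma OidInv.step (H : OidInv g π) {i : Fin n} {m : M} {p p' : Local n M A B}
    (hp : π i = some (m, p)) (hs : Step Spec i (p, g) (p', g')) :
    OidInv g' (Function.update π i (some (m, p'))) := by
  have hinv : ∀ (g : Shared n M A B) (r : Ref) (nd : Node n M A B), nd.inv = (g.node r).inv →
      ∀ o, ((setNode g r nd).node (some o)).inv = (g.node (some o)).inv :=
    fun g r nd h o => field_setNode Node.inv h _
  have not_fresh : ∀ {p' : Local n M A B}, p'.fresh = none →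
      ∀ m' q, some (m, p') = some (m', q) → q.fresh = none := by
    intro p' h m' q hq
    obtain ⟨-, rfl⟩ := Prod.mk.inj (Option.some.inj hq)
    exact h
  cases hs with
  | genID _ m' a o ho =>
    refine ⟨?_, ?_, ?_, fun o' h => .inr (H.recorded_used o' h),
      fun o' h => .inr (H.inv_used o' h), H.nodup⟩
    · intro j k q o' h1 h2
      by_cases hj : j = i
      · subst hj
        simp only [Function.update_self, Option.some.injEq, Prod.mk.injEq] at h1
        obtain ⟨-, rfl⟩ := h1
        obtain rfl : o = o' := by simpa [Local.fresh] using h2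
        refine ⟨.inl rfl, ?_⟩
        by_contra hc
        exact ho (H.inv_used o hc)
      · rw [Function.update_of_ne hj] at h1
        have := H.fresh j k q o' h1 h2
        exact ⟨.inr this.1, this.2⟩
    · intro j j' k k' q q' o' h1 h2 h3 h4
      by_cases hj : j = i <;> by_cases hj' : j' = i
      · rw [hj, hj']
      · subst hj
        simp only [Function.update_self, Option.some.injEq, Prod.mk.injEq] at h1
        obtain ⟨-, rfl⟩ := h1
        obtain rfl : o = o' := by simpa [Local.fresh] using h3
        rw [Function.update_of_ne hj'] at h2
        exact (ho (H.fresh j' k' q' o h2 h4).1).elim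
      · subst hj'
        simp only [Function.update_self, Option.some.injEq, Prod.mk.injEq] at h2
        obtain ⟨-, rfl⟩ := h2
        obtain rfl : o = o' := by simpa [Local.fresh] using h4
        rw [Function.update_of_ne hj] at h1
        exact (ho (H.fresh j k q o h1 h3).1).elim
      · rw [Function.update_of_ne hj] at h1
        rw [Function.update_of_ne hj'] at h2
        exact H.fresh_inj j j' k k' q q' o' h1 h2 h3 h4
    · intro j k m'' a' o' h
      by_cases hj : j = i
      · subst hj
        simp only [Function.update_self, Option.some.injEq, Prod.mk.injEq,
          Local.storeCall.injEq] at h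
        obtain ⟨-, -, -, rfl⟩ := h
        exact fun hc => ho (H.recorded_used o hc)
      · rw [Function.update_of_ne hj] at h
        exact H.unrecorded j k m'' a' o' h
  | storeCall _ m' a o =>
    have htags : callTags (g.recorder ++ [.call i m' a o]) = callTags g.recorder ++ [o] := by
      rw [callTags_append]; rfl
    have key : ∀ {j k q o'}, Function.update π i (some (m, .announceNode m' a o)) j = some (k, q) →
        q.fresh = some o' → ∃ k' q', π j = some (k', q') ∧ q'.fresh = some o' := by
      intro j k q o' h1 h2
      by_cases hj : j = i
      · subst hj
        simp only [Function.update_self, Option.some.injEq, Prod.mk.injEq] at h1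
        obtain ⟨-, rfl⟩ := h1
        exact ⟨_, _, hp, h2⟩
      · rw [Function.update_of_ne hj] at h1
        exact ⟨_, _, h1, h2⟩
    refine ⟨?_, ?_, ?_, ?_, H.inv_used, ?_⟩
    · intro j k q o' h1 h2
      obtain ⟨k', q', h3, h4⟩ := key h1 h2
      exact H.fresh j k' q' o' h3 h4
    · intro j j' k k' q q' o' h1 h2 h3 h4
      obtain ⟨k₁, q₁, h5, h6⟩ := key h1 h3
      obtain ⟨k₂, q₂, h7, h8⟩ := key h2 h4
      exact H.fresh_inj j j' k₁ k₂ q₁ q₂ o' h5 h7 h6 h8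
    · intro j k m'' a' o' h
      by_cases hj : j = i
      · subst hj
        simp at h
      · rw [Function.update_of_ne hj] at h
        simp only [htags, List.mem_append, List.mem_singleton, not_or]
        refine ⟨H.unrecorded j k m'' a' o' h, ?_⟩
        rintro rfl
        exact hj (H.fresh_inj j i _ _ _ _ o' h hp rfl rfl)
    · simp only [htags, List.mem_append, List.mem_singleton]
      rintro o' (h | rfl)
      · exact H.recorded_used o' h
      · exact (H.fresh i _ _ o' hp rfl).1
    · simp only [htags]
      rw [List.nodup_append]
      refine ⟨H.nodup, by simp, ?_⟩
      rintro x hx y hy rfl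
      obtain rfl : x = o := by simpa using hy
      exact H.unrecorded i _ _ _ _ hp hx
  | announceNode _ m' a o =>
    have key : ∀ {j k q o'}, Function.update π i (some (m, .maxHead m' o)) j = some (k, q) →
        q.fresh = some o' → j ≠ i ∧ π j = some (k, q) := by
      intro j k q o' h1 h2
      by_cases hj : j = i
      · subst hj
        simp only [Function.update_self, Option.some.injEq, Prod.mk.injEq] at h1
        obtain ⟨-, rfl⟩ := h1
        simp [Local.fresh] at h2
      · rw [Function.update_of_ne hj] at h1
        exact ⟨hj, h1⟩
    refine ⟨?_, ?_, ?_, H.recorded_used, ?_, H.nodup⟩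
    · intro j k q o' h1 h2
      obtain ⟨hj, h3⟩ := key h1 h2
      have hne : o' ≠ o := by
        rintro rfl
        exact hj (H.fresh_inj j i _ _ _ _ o' h3 hp h2 rfl)
      have := H.fresh j k q o' h3 h2
      exact ⟨this.1, by simpa [setNode, hne] using this.2⟩
    · intro j j' k k' q q' o' h1 h2 h3 h4
      exact H.fresh_inj j j' _ _ _ _ o' (key h1 h3).2 (key h2 h4).2 h3 h4
    · intro j k m'' a' o' h
      exact H.unrecorded j k m'' a' o' (key h rfl).2
    · intro o' h
      by_cases hne : o' = o
      · subst hne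
        exact (H.fresh i _ _ o' hp rfl).1
      · exact H.inv_used o' (by simpa [setNode, hne] using h)
  | decide | casHist | casLin | setNext | setSeq =>
    exact H.update_of_not_fresh (not_fresh rfl) rfl (hinv _ _ _ rfl) rfl
  | storeReturn =>
    refine H.update_of_not_fresh (not_fresh rfl) rfl (fun _ => rfl) ?_
    rw [callTags_append]
    exact List.append_nil _
  | _ => exact H.update_of_not_fresh (not_fresh rfl) rfl (fun _ => rfl) rfl

/-! ### The recorded history and the actual history -/

/-- The part of the local state that determines how the recorder lags behind, or runs ahead of, the
actual history. -/
inductive Phase (M A B : Type*)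
  | called (m : M) (a : A)
  | recorded (m : M) (o : ℕ)
  | returned (b : B)

/-- The phase of a process: its call is not yet recorded, or it is recorded, or also the return is
recorded. -/
def Local.phase : Local n M A B → Phase M A B
  | .genID m a | .storeCall m a _ => .called m a
  | .announceNode m _ o | .maxHead m o | .loopTest m o | .readBefore m o | .readHelp m o _
  | .testHelp m o _ _ | .preferHelp m o _ _ | .preferOwn m o _ | .decide m o _ _
  | .readHist m o _ _ | .casHist m o _ _ _ | .genLin m o _ _ | .casLin m o _ _ _
  | .setNext m o _ _ | .setSeq m o _ _ | .setHead m o _ | .setHeadOwn m o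
  | .getRetValue m o | .storeReturn m o _ => .recorded m o
  | .done b => .returned b

/-- The subhistory `h` of process `i` and the list `t` of its recorded actions, depending on the
phase of the process. -/
def ProcHist (i : Fin n) (h : List (Event n M A B Unit)) (t : Hist n M A B) :
    Option (M × Phase M A B) → Prop
  | none => Paired t ∧ h = untag t
  | some (m, .called m' a) => m' = m ∧ Paired t ∧ h = untag t ++ [.call i m a ()]
  | some (m, .recorded m' o) => m' = m ∧ ∃ q a, Paired q ∧ t = q ++ [.call i m a o] ∧ h = untag t
  | some (m, .returned b) => ∃ q a o, Paired q ∧ t = q ++ [.call i m a o, .ret i m b o] ∧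
      h = untag q ++ [.call i m a ()]

/-- The phase of a process that may be idle. -/
def phaseOf (x : Option (M × Local n M A B)) : Option (M × Phase M A B) :=
  x.map fun y => (y.1, y.2.phase)

lemma ProcHist.exists_completion {i : Fin n} {h : List (Event n M A B Unit)} {t : Hist n M A B}
    {x : Option (M × Phase M A B)} (H : ProcHist i h t x) : ∃ c, Completion t c := by
  match x, H with
  | none, H => exact ⟨_, H.1.completion⟩
  | some (m, .called m' a), H => exact ⟨_, H.2.1.completion⟩
  | some (m, .recorded m' o), ⟨_, q, a, h1, h2, _⟩ =>
    exact ⟨q ++ [], h2 ▸ h1.completion_append (.drop _ _ _ _)⟩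
  | some (m, .returned b), ⟨q, a, o, h1, h2, _⟩ =>
    exact ⟨_, h2 ▸ h1.completion_append (.cons _ _ _ _ _ .nil)⟩

/-- A completion of what is recorded of a process is one of its actual subhistory. -/
lemma ProcHist.completion {i : Fin n} {h : List (Event n M A B Unit)} {t c : Hist n M A B}
    {x : Option (M × Phase M A B)} (H : ProcHist i h t x) (hc : Completion t c) :
    Completion h (untag c) := by
  match x, H with
  | none, H => exact H.2 ▸ hc.untag
  | some (m, .called m' a), ⟨_, h1, h2⟩ =>
    rw [h1.eq_of_completion hc, h2]
    simpa using h1.untag.completion_append (.drop i m a ())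
  | some (m, .recorded m' o), ⟨_, q, a, h1, _, h2⟩ => exact h2 ▸ hc.untag
  | some (m, .returned b), ⟨q, a, o, h1, h2, h3⟩ =>
    have : Paired t := h2 ▸ h1.append (.cons _ _ _ _ _ .nil)
    rw [this.eq_of_completion hc, h2, h3, untag_append]
    exact h1.untag.completion_append (.finish i m a b ())

lemma ProcHist.numCalls_le {i : Fin n} {h : List (Event n M A B Unit)} {t : Hist n M A B}
    {x : Option (M × Phase M A B)} (H : ProcHist i h t x) : numCalls i t ≤ numCalls i h := by
  match x, H with
  | none, H => rw [H.2]; simp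
  | some (m, .called m' a), ⟨_, _, h2⟩ => rw [h2]; simp
  | some (m, .recorded m' o), ⟨_, q, a, _, _, h2⟩ => rw [h2]; simp
  | some (m, .returned b), ⟨q, a, o, _, h2, h3⟩ =>
    rw [h2, h3]; simp [numCalls_cons, Event.isCall, Event.pid]

lemma ProcHist.numRets_le {i : Fin n} {h : List (Event n M A B Unit)} {t : Hist n M A B}
    {x : Option (M × Phase M A B)} (H : ProcHist i h t x) : numRets i h ≤ numRets i t := by
  match x, H with
  | none, H => rw [H.2]; simp
  | some (m, .called m' a), ⟨_, _, h2⟩ => rw [h2]; simp [numRets_cons, Event.isCall]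
  | some (m, .recorded m' o), ⟨_, q, a, _, _, h2⟩ => rw [h2]; simp
  | some (m, .returned b), ⟨q, a, o, _, h2, h3⟩ =>
    rw [h2, h3]; simp [numRets_cons, Event.isCall]

/-- The recorder `t` and the actual history `h`: operations are recorded within their actual
duration, so that the recorder can only have more happen-before pairs. -/
structure RecInv (h : List (Event n M A B Unit)) (t : Hist n M A B)
    (φ : Fin n → Option (M × Phase M A B)) : Prop where
  proc : ∀ i, ProcHist i (sub i h) (sub i t) (φ i)
  order : ∀ i k j l, HappensBefore h i k j l → l < numCalls j t → HappensBefore t i k j l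

section RecInv

variable {h : List (Event n M A B Unit)} {t : Hist n M A B} {φ : Fin n → Option (M × Phase M A B)}

lemma RecInv.numCalls_le (H : RecInv h t φ) (i : Fin n) : numCalls i t ≤ numCalls i h := by
  rw [← numCalls_sub, ← numCalls_sub i h]; exact (H.proc i).numCalls_le

lemma RecInv.numRets_le (H : RecInv h t φ) (i : Fin n) : numRets i h ≤ numRets i t := by
  rw [← numRets_sub, ← numRets_sub i t]; exact (H.proc i).numRets_le

lemma RecInv.append_event (H : RecInv h t φ) {i : Fin n} {x : Option (M × Phase M A B)}
    {e : Event n M A B Unit} (he : e.pid = i)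
    (hx : ProcHist i (sub i h ++ [e]) (sub i t) x) :
    RecInv (h ++ [e]) t (Function.update φ i x) := by
  refine ⟨fun j => ?_, fun i k j l hb hl => H.order i k j l (hb.of_append ?_) hl⟩
  · by_cases hj : j = i
    · subst hj; simpa [sub_cons, he] using hx
    · simpa [sub_cons, he, hj, Ne.symm hj] using H.proc j
  · exact hl.trans_le (H.numCalls_le j)

lemma RecInv.append_record (H : RecInv h t φ) {i : Fin n} {x : Option (M × Phase M A B)}
    {e : Event n M A B ℕ} (he : e.pid = i)
    (hx : ProcHist i (sub i h) (sub i t ++ [e]) x) :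
    RecInv h (t ++ [e]) (Function.update φ i x) := by
  refine ⟨fun j => ?_, fun i' k j l hb hl => ?_⟩
  · by_cases hj : j = i
    · subst hj; simpa [sub_cons, he] using hx
    · simpa [sub_cons, he, hj, Ne.symm hj] using H.proc j
  · by_cases hl' : l < numCalls j t
    · exact (H.order i' k j l hb hl').append _
    · -- the new action is the call of the later operation
      obtain ⟨u, v, rfl, h1, h2, h3⟩ := hb
      have := H.numRets_le i'
      rw [numRets_append] at this
      exact ⟨t, [e], rfl, by omega, not_lt.1 hl', hl⟩

end RecInv

/-! ### The universal construction is linearizable -/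

/-- The invariant of the whole system after the history `h`. -/
structure SysInv (Spec : Set (List (Operation M A B))) (h : List (Event n M A B Unit))
    (g : Shared n M A B) (π : Fin n → Option (M × Local n M A B)) (pos : Ref → ℕ) : Prop where
  mem : Inv Spec g pos
  loc : ∀ i m p, π i = some (m, p) → LocInv Spec g pos i p
  oid : OidInv g π
  record : RecInv h g.recorder fun i => phaseOf (π i)

lemma phaseOf_update (i : Fin n) (x : Option (M × Local n M A B)) :
    (fun j => phaseOf (Function.update π i x j)) =
      Function.update (fun j => phaseOf (π j)) i (phaseOf x) := by
  funext j
  by_cases hj : j = i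
  · subst hj; simp
  · simp [hj]

section System

variable {h : List (Event n M A B Unit)} {pos : Ref → ℕ}

lemma sysInv_init : SysInv Spec [] (initShared : Shared n M A B) (fun _ => none)
    (fun r => if r = none then 1 else 0) := by
  refine ⟨inv_initShared, by simp, ⟨by simp, by simp, by simp, ?_, ?_, ?_⟩, ⟨fun i => ?_, ?_⟩⟩
  · simp [initShared, callTags]
  · simp [initShared, newNode]
  · simp [initShared, callTags]
  · exact ⟨.nil, rfl⟩
  · rintro i k j l ⟨u, v, -, -, -, h3⟩
    simp at h3

lemma SysInv.call (H : SysInv Spec h g π pos) {i : Fin n} (hi : π i = none) (m : M) (a : A) :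
    SysInv Spec (h ++ [.call i m a ()]) g (Function.update π i (some (m, .genID m a))) pos := by
  refine ⟨H.mem, fun j k p hj => ?_, ?_, ?_⟩
  · by_cases hji : j = i
    · subst hji
      simp only [Function.update_self, Option.some.injEq, Prod.mk.injEq] at hj
      obtain ⟨-, rfl⟩ := hj
      trivial
    · rw [Function.update_of_ne hji] at hj
      exact H.loc j k p hj
  · refine H.oid.update_of_not_fresh (fun m' p hp => ?_) rfl (fun _ => rfl) rfl
    obtain ⟨-, rfl⟩ := Prod.mk.inj (Option.some.inj hp)
    rfl
  · rw [phaseOf_update]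
    refine H.record.append_event rfl ?_
    have := H.record.proc i
    simp only [hi] at this
    obtain ⟨h1, h2⟩ := this
    exact ⟨rfl, h1, by rw [h2]⟩

lemma SysInv.ret (H : SysInv Spec h g π pos) {i : Fin n} {m : M} {b : B}
    (hi : π i = some (m, .done b)) :
    SysInv Spec (h ++ [.ret i m b ()]) g (Function.update π i none) pos := by
  refine ⟨H.mem, fun j k p hj => ?_, ?_, ?_⟩
  · by_cases hji : j = i
    · subst hji
      simp at hj
    · rw [Function.update_of_ne hji] at hj
      exact H.loc j k p hj
  · exact H.oid.update_of_not_fresh (by simp) rfl (fun _ => rfl) rfl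
  · rw [phaseOf_update]
    refine H.record.append_event rfl ?_
    have := H.record.proc i
    simp only [hi] at this
    obtain ⟨q, a, o, h1, h2, h3⟩ := this
    exact ⟨h2 ▸ h1.append (.cons _ _ _ _ _ .nil), by rw [h2, h3]; simp [Event.untag]⟩

lemma SysInv.step (H : SysInv Spec h g π pos) {i : Fin n} {m : M} {p p' : Local n M A B}
    (hi : π i = some (m, p)) (hs : Step Spec i (p, g) (p', g')) :
    ∃ pos', SysInv Spec h g' (Function.update π i (some (m, p'))) pos' := by
  obtain ⟨pos', h1, h2, h3, h4⟩ := H.mem.step (H.loc i m p hi)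
    (fun m' a o hp => (H.oid.fresh i m p o hi (by rw [hp]; rfl)).2) hs
  refine ⟨pos', h1, fun j k q hj => ?_, H.oid.step hi hs, ?_⟩
  · by_cases hji : j = i
    · subst hji
      simp only [Function.update_self, Option.some.injEq, Prod.mk.injEq] at hj
      obtain ⟨-, rfl⟩ := hj
      exact h2
    · rw [Function.update_of_ne hji] at hj
      exact (H.loc j k q hj).later H.mem h3 (h4 j hji).1 (h4 j hji).2
  · rw [phaseOf_update]
    have hproc := H.record.proc i
    simp only [hi] at hproc
    have hsame : p'.phase = p.phase →
        Function.update (fun j => phaseOf (π j)) i (phaseOf (some (m, p'))) =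
          fun j => phaseOf (π j) := by
      intro heq
      rw [Function.update_eq_self_iff, hi]
      simp [phaseOf, heq]
    cases hs with
    | storeCall _ m' a o =>
      obtain ⟨rfl, h5, h6⟩ := hproc
      exact H.record.append_record rfl ⟨rfl, _, a, h5, rfl, by rw [h6]; simp [Event.untag]⟩
    | storeReturn _ m' o b =>
      obtain ⟨rfl, q, a, h5, h6, h7⟩ := hproc
      exact H.record.append_record rfl ⟨q, a, o, h5, by rw [h6]; simp,
        by rw [h7, h6]; simp [Event.untag]⟩
    | _ => rw [hsame rfl]; exact H.record

/-- The linearization in the last node that has one linearizes the actual history: it contains all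
operations that have returned, with their return values. -/
lemma SysInv.linearizable (H : SysInv Spec h g π pos) (hnil : [] ∈ Spec) : Linearizable Spec h := by
  have hd := H.oid.nodup
  obtain ⟨h₀, L, hpre, hlin, hval⟩ : ∃ h₀ L, h₀ <+: g.recorder ∧ IsLinearization Spec h₀ L ∧
      ∀ o b, Val g o b → HasRet L o b := by
    by_cases hex : ∃ r l, (g.node r).lin = some l
    · obtain ⟨r, ⟨L, hL⟩, hmax⟩ : ∃ r, (∃ l, (g.node r).lin = some l) ∧
          ∀ r' l', (g.node r').lin = some l' → pos r' ≤ pos r := by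
        obtain ⟨K, hK⟩ := H.mem.bounded
        set s : Set ℕ := {k | ∃ r l, (g.node r).lin = some l ∧ pos r = k} with hs
        have hbdd : BddAbove s := ⟨K, by rintro k ⟨r, l, -, rfl⟩; exact hK r⟩
        have hne : s.Nonempty := by
          obtain ⟨r, l, hl⟩ := hex
          exact ⟨pos r, r, l, hl, rfl⟩
        obtain ⟨r, l, hl, hr⟩ := Nat.sSup_mem hne hbdd
        refine ⟨r, ⟨l, hl⟩, fun r' l' h' => ?_⟩
        rw [hr]
        exact le_csSup hbdd ⟨r', l', h', rfl⟩
      obtain ⟨h2, ⟨h₀, hpre, hlin⟩, ⟨o, b, rfl, hown⟩, hearlier⟩ := H.mem.lin r L hL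
      refine ⟨h₀, L, hpre, hlin, fun o' b' => ?_⟩
      rintro ⟨l, hl, hret⟩
      obtain ⟨h3, ⟨h₁, hpre₁, hlin₁⟩, -, -⟩ := H.mem.lin _ l hl
      have hle := hmax _ _ hl
      rcases hle.eq_or_lt with heq | hlt
      · obtain rfl : o' = o := by simpa using H.mem.pos_inj _ _ (by omega) heq
        obtain rfl : L = l := by rw [hL] at hl; simpa using hl
        exact hret
      · obtain ⟨l₀, b'', h4, ⟨i₁, m₁, h5⟩, h6⟩ := hearlier o' (by omega) hlt
        obtain rfl : l = l₀ := by rw [hl] at h4; simpa using h4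
        obtain ⟨i₂, m₂, hret⟩ := hret
        have hd₁ : (callTags h₁).Nodup := hd.sublist (hpre₁.sublist.filterMap _)
        obtain rfl := hlin₁.ret_unique hd₁ h5 hret
        exact h6
    · refine ⟨[], [], List.nil_prefix, ?_, ?_⟩
      · refine isLinearization_iff.2 ⟨⟨[], hnil, rfl⟩, fun _ => .nil, ?_⟩
        intro i k j l _ hl
        simp at hl
      · rintro o b ⟨l, hl, -⟩
        exact (hex ⟨_, l, hl⟩).elim
  obtain ⟨hL1, hL2, hL3⟩ := isLinearization_iff.1 hlin
  have hmem : ∀ i m b o, Event.ret i m b o ∈ g.recorder → Event.ret i m b o ∈ L := by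
    intro i m b o ho
    obtain ⟨i', m', ho'⟩ := hval o b (H.mem.ret i m b o ho)
    obtain ⟨c, hc⟩ := (H.record.proc i).exists_completion
    obtain ⟨a, ha⟩ := hc.paired.exists_call (hc.ret_mem (mem_sub.2 ⟨ho, rfl⟩))
    obtain ⟨a', ha'⟩ := (hL2 i').paired.exists_call (mem_sub.2 ⟨ho', rfl⟩)
    obtain ⟨rfl, rfl⟩ := call_eq_of_callTags_nodup hd (mem_sub.1 (hc.call_mem ha)).1
      (hpre.subset (mem_sub.1 ((hL2 i').call_mem ha')).1)
    exact ho'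
  refine ⟨untag L, isLinearization_iff.2 ⟨untag_mem_toHistory hL1, fun i => ?_, ?_⟩⟩
  · rw [sub_untag]
    refine (H.record.proc i).completion ((hL2 i).of_prefix (H.record.proc i).exists_completion
      (hpre.filter _) (hd.sublist (callTags_sublist_sub i _)) fun i' m b o ho => ?_)
    obtain ⟨h1, h2⟩ := mem_sub.1 ho
    exact mem_sub.2 ⟨hmem _ _ _ _ h1, h2⟩
  · intro i k j l hb hl
    rw [numCalls_untag] at hl
    have h1 : numCalls j L ≤ numCalls j h₀ := by
      rw [← numCalls_sub, ← numCalls_sub j h₀]; exact (hL2 j).numCalls_le j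
    have h2 : numCalls j h₀ ≤ numCalls j g.recorder := hpre.sublist.countP_le
    rw [happensBefore_untag]
    exact hL3 _ _ _ _ ((H.record.order _ _ _ _ hb (by omega)).of_prefix hpre (by omega)) hl

end System

end Universal

theorem USpec_isLinearizable {M A B : Type*} {Spec : Set (List (Operation M A B))}
    (hnil : [] ∈ Spec) (n : ℕ) : (USpec Spec n).IsLinearizable Spec := by
  rintro e ⟨q, hq⟩
  suffices ∀ p l q, (USpec Spec n).sem.Path p l q → ∀ h pos,
      Universal.SysInv Spec h p.shared p.proc pos →
      ∃ pos', Universal.SysInv Spec (h ++ history l) q.shared q.proc pos' by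
    obtain ⟨pos, H⟩ := this _ _ _ hq [] _ Universal.sysInv_init
    exact H.linearizable hnil
  intro p l q hpath
  induction hpath with
  | nil p =>
    intro h pos H
    exact ⟨pos, by simpa [history] using H⟩
  | cons ht _ ih =>
    intro h pos H
    rw [history_cons, ← List.append_assoc]
    cases ht with
    | call i m a hi => exact ih _ _ (H.call hi m a)
    | step i m p p' cmd g' hi hs =>
      obtain ⟨pos', H'⟩ := H.step hi hs
      exact ih _ pos' (show Universal.SysInv Spec (h ++ []) _ _ _ by rwa [List.append_nil])
    | ret i m p b hi hb =>
      obtain rfl : p = .done b := hb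
      exact ih _ _ (H.ret hi)

namespace Universal

variable {n : ℕ} {M A B : Type*} {Spec : Set (List (Operation M A B))}
variable {g g' : Shared n M A B} {π : Fin n → Option (M × Local n M A B)}

/-! ### Solo runs of a process -/

/-- Process `i` executes finitely many commands without interruption. -/
def Run (Spec : Set (List (Operation M A B))) (i : Fin n) :
    Local n M A B × Shared n M A B → Local n M A B × Shared n M A B → Prop :=
  Relation.ReflTransGen (Step Spec i)

lemma OidInv.run (H : OidInv g π) {i : Fin n} {m : M} {p p' : Local n M A B}
    (hp : π i = some (m, p)) (hr : Run Spec i (p, g) (p', g')) :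
    OidInv g' (Function.update π i (some (m, p'))) := by
  obtain ⟨s, hs⟩ : ∃ s, s = (p', g') := ⟨_, rfl⟩
  rw [← hs] at hr
  induction hr generalizing p' g' with
  | refl =>
    cases hs
    rwa [← hp, Function.update_eq_self]
  | @tail s _ _ hstep ih =>
    obtain ⟨q, g₁⟩ := s
    subst hs
    simpa using (ih rfl).step (i := i) (m := m) (p := q) (by simp) hstep

/-- The configuration of the universal construction with memory `g` and local states `π`. -/
def config (Spec : Set (List (Operation M A B))) (g : Shared n M A B)
    (π : Fin n → Option (M × Local n M A B)) : (USpec Spec n).Config := ⟨g, π⟩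

lemma config_call {i : Fin n} (hi : π i = none) (m : M) (a : A) :
    (USpec Spec n).sem.Tr (config Spec g π) (.event (.call i m a ()))
      (config Spec g (Function.update π i (some (m, .genID m a)))) :=
  .call (O := USpec Spec n) ⟨g, π⟩ i m a hi

lemma config_step {i : Fin n} {m : M} {p p' : Local n M A B} (hi : π i = some (m, p))
    (hs : Step Spec i (p, g) (p', g')) :
    (USpec Spec n).sem.Tr (config Spec g π) (.internal i ())
      (config Spec g' (Function.update π i (some (m, p')))) :=
  .step (O := USpec Spec n) ⟨g, π⟩ i m p p' () g' hi hs

lemma config_ret {i : Fin n} {m : M} {b : B} (hi : π i = some (m, .done b)) :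
    (USpec Spec n).sem.Tr (config Spec g π) (.event (.ret i m b ()))
      (config Spec g (Function.update π i none)) :=
  .ret (O := USpec Spec n) ⟨g, π⟩ i m (.done b) b hi rfl

lemma Run.exists_path {i : Fin n} {m : M} {p p' : Local n M A B} (hp : π i = some (m, p))
    (hr : Run Spec i (p, g) (p', g')) :
    ∃ l, (USpec Spec n).sem.Path (config Spec g π) l
      (config Spec g' (Function.update π i (some (m, p')))) ∧ history l = [] := by
  obtain ⟨s, hs⟩ : ∃ s, s = (p', g') := ⟨_, rfl⟩
  rw [← hs] at hr
  induction hr generalizing p' g' with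
  | refl =>
    cases hs
    rw [← hp, Function.update_eq_self]
    exact ⟨[], .nil _, rfl⟩
  | @tail s _ _ hstep ih =>
    obtain ⟨q, g₁⟩ := s
    subst hs
    obtain ⟨l, h1, h2⟩ := ih rfl
    refine ⟨l ++ [.internal i ()], h1.append (.cons ?_ (.nil _)), ?_⟩
    · have := config_step (π := Function.update π i (some (m, q))) (i := i) (m := m) (by simp) hstep
      rwa [Function.update_idem] at this
    · rw [history_append, h2]; rfl

/-- The memory `g` after process `i` has announced the node `o`, and with `x`, `y` as the nodes `o`
and `last` and with `hd` as `head[i]`. -/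
def runMem (g : Shared n M A B) (i : Fin n) (o : ℕ) (last : Ref) (x y : Node n M A B) (hd : Ref) :
    Shared n M A B where
  used := g.used
  recorder := g.recorder
  node r := if r = some o then x else if r = last then y else g.node r
  head := Function.update g.head i hd
  announce := Function.update g.announce i (some o)

section RunMem

variable {i : Fin n} {o : ℕ} {last : Ref} {x y x' y' : Node n M A B} {hd hd' : Ref}

@[simp] lemma runMem_node_own : (runMem g i o last x y hd).node (some o) = x := by simp [runMem]

lemma runMem_node_last (hne : last ≠ some o) : (runMem g i o last x y hd).node last = y := by
  simp [runMem, hne]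

lemma runMem_node_ne {r : Ref} (h1 : r ≠ some o) (h2 : r ≠ last) :
    (runMem g i o last x y hd).node r = g.node r := by
  simp [runMem, h1, h2]

lemma setNode_runMem_own :
    setNode (runMem g i o last x y hd) (some o) x' = runMem g i o last x' y hd := by
  simp only [setNode, runMem, Shared.mk.injEq, true_and, and_true]
  funext r
  by_cases h : r = some o <;> simp [h]

lemma setNode_runMem_last (hne : last ≠ some o) :
    setNode (runMem g i o last x y hd) last y' = runMem g i o last x y' hd := by
  simp only [setNode, runMem, Shared.mk.injEq, true_and, and_true]
  funext r
  by_cases h : r = last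
  · subst h; simp [hne]
  · simp [h]

lemma setHead_runMem :
    Universal.setHead (runMem g i o last x y hd) i hd' = runMem g i o last x y hd' := by
  simp [Universal.setHead, runMem]

end RunMem

/-- The node `o` when the solo run of its process is over. -/
def ownNode (g : Shared n M A B) (last : Ref) (m : M) (a : A) (L : Hist n M A B) :
    Node n M A B where
  inv := some (m, a)
  hist := some g.recorder
  lin := some L
  decideNext := none
  seq := (g.node last).seq + 1
  next := none

/-- The formerly last node when the node `o` is linked to it. -/
def linkNode (g : Shared n M A B) (last : Ref) (o : ℕ) : Node n M A B :=
  { g.node last with decideNext := some (some o), next := some (some o) }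

/-! ### States in which all called operations wait for being announced -/

/-- Process `i`, with recorded actions `t`, is idle, or it executes method `m` and has recorded its
call but not yet announced its operation. -/
def Waiting (i : Fin n) (t : Hist n M A B) : Option M → Option (M × Local n M A B) → Prop
  | none, x => x = none ∧ Paired t
  | some m, x => ∃ a o q, x = some (m, .announceNode m a o) ∧ Paired q ∧
      t = q ++ [.call i m a o]

/-- The states of the universal construction to which the states of a linearizable object are
related. The history is `h`, `φ` gives the method that each process executes, and the nodes of the
linked list, which ends with `last`, belong to the operations that have returned. -/
structure Quiet (h : List (Event n M A B Unit)) (g : Shared n M A B) (φ : Fin n → Option M)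
    (π : Fin n → Option (M × Local n M A B)) (last : Ref) : Prop where
  waiting : ∀ i, Waiting i (sub i g.recorder) (φ i) (π i)
  recorder : untag g.recorder = h
  oid : OidInv g π
  finite : g.used.Finite
  raw : ∀ o, (g.node (some o)).inv = none → g.node (some o) = newNode none
  announce : ∀ i, (g.node (g.announce i)).seq ≠ 0
  reaches : Reaches g none last
  decideNext : (g.node last).decideNext = none
  next : (g.node last).next = none
  seq : (g.node last).seq ≠ 0
  head_le : ∀ i, (g.node (g.head i)).seq ≤ (g.node last).seq
  head_eq : Fin n → ∃ j, g.head j = last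
  vals : ∀ o, Reaches g none (some o) → ∃ l b i m, (g.node (some o)).lin = some l ∧
    HasRet l o b ∧ Event.ret i m b o ∈ g.recorder

section Quiet

variable {h : List (Event n M A B Unit)} {φ : Fin n → Option M} {last : Ref}

lemma quiet_init : Quiet [] (initShared : Shared n M A B) (fun _ => none) (fun _ => none) none := by
  have hn : ∀ r, ((initShared : Shared n M A B).node r).next = none := fun r => by
    by_cases hr : r = none <;> simp [initShared, hr, newNode]
  refine ⟨fun i => ⟨rfl, .nil⟩, rfl, sysInv_init (Spec := ∅) |>.oid, Set.finite_empty,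
    fun o _ => ?_, fun i => ?_, .refl, ?_, hn _, ?_, fun i => le_rfl, fun i => ⟨i, rfl⟩, ?_⟩
  · simp [initShared]
  · simp [initShared]
  · simp [initShared, newNode]
  · simp [initShared]
  · intro o ho
    rcases Relation.ReflTransGen.cases_tail ho with h | ⟨r, -, h⟩
    · simp at h
    · rw [hn] at h; simp at h

lemma Quiet.isHistory (H : Quiet h g φ π last) : IsHistory g.recorder := by
  intro i
  have := H.waiting i
  cases hφ : φ i with
  | none =>
    rw [hφ] at this
    exact this.2.completion.isSequential
  | some m =>
    rw [hφ] at this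
    obtain ⟨a, o, q, -, hq, ht⟩ := this
    rw [ht]
    exact (hq.completion_append (.drop i m a o)).isSequential

/-- The call of an operation: its identity is generated and its call recorded. -/
lemma Quiet.call (H : Quiet h g φ π last) {i : Fin n} (hi : φ i = none) (m : M) (a : A) :
    ∃ g' π' l, (USpec Spec n).sem.Path (config Spec g π) l (config Spec g' π') ∧
      history l = [.call i m a ()] ∧
      Quiet (h ++ [.call i m a ()]) g' (Function.update φ i (some m)) π' last := by
  obtain ⟨o, ho⟩ := H.finite.exists_notMem
  have hw := H.waiting i
  rw [hi] at hw
  obtain ⟨hπ, hpair⟩ := hw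
  have r1 := Step.genID (Spec := Spec) (i := i) g m a o ho
  have r2 := Step.storeCall (Spec := Spec) (i := i) { g with used := insert o g.used } m a o
  have hrun : Run Spec i (.genID m a, g) (.announceNode m a o,
      { g with used := insert o g.used, recorder := g.recorder ++ [.call i m a o] }) :=
    .tail (.single r1) r2
  have h1 : OidInv g (Function.update π i (some (m, .genID m a))) := by
    refine H.oid.update_of_not_fresh (fun m' p hp => ?_) rfl (fun _ => rfl) rfl
    obtain ⟨-, rfl⟩ := Prod.mk.inj (Option.some.inj hp)
    rfl
  have h2 := h1.run (i := i) (m := m) (Function.update_self ..) hrun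
  obtain ⟨l, h3, h4⟩ := hrun.exists_path
    (π := Function.update π i (some (m, .genID m a))) (m := m) (Function.update_self ..)
  rw [Function.update_idem] at h2 h3
  refine ⟨_, _, .event (.call i m a ()) :: l, .cons ?_ h3, ?_, ⟨?_, ?_, h2, H.finite.insert o,
    H.raw, H.announce, H.reaches, H.decideNext, H.next, H.seq, H.head_le, H.head_eq, ?_⟩⟩
  · exact config_call hπ m a
  · rw [history_cons, h4]; rfl
  · intro j
    by_cases hj : j = i
    · subst hj
      simp only [Function.update_self, sub_append]
      exact ⟨a, o, _, rfl, hpair, by simp [sub_cons, Event.pid]⟩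
    · rw [Function.update_of_ne hj, Function.update_of_ne hj]
      simpa [sub_cons, Event.pid, Ne.symm hj] using H.waiting j
  · rw [← H.recorder]; simp [Event.untag]
  · intro o' ho'
    obtain ⟨l, b, i', m', h5, h6, h7⟩ := H.vals o' ho'
    exact ⟨l, b, i', m', h5, h6, List.mem_append_left _ h7⟩

/-- A solo run of a process that appends its own node to the list and chooses `L` as the
linearization. No help is given, because all other announced nodes are already in the list. -/
lemma Quiet.run (H : Quiet h g φ π last) {i : Fin n} {m : M} {a : A} {o : ℕ}
    (ho : (g.node (some o)).inv = none) {L : Hist n M A B} {b : B}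
    (hL : IsLinearization Spec g.recorder L) (hb : HasRet L o b)
    (hvals : ∀ o' : ℕ, Reaches g none (some o') →
      ∃ l₀ b, (g.node (some o')).lin = some l₀ ∧ HasRet l₀ o' b ∧ HasRet L o' b)
    (hreach : Reaches (runMem g i o last (ownNode g last m a L) (linkNode g last o) (some o))
      none (some o)) :
    Run Spec i (.announceNode m a o, g) (.done b,
      { runMem g i o last (ownNode g last m a L) (linkNode g last o) (some o) with
        recorder := g.recorder ++ [.ret i m b o] }) := by
  have hraw := H.raw o ho
  have hne : last ≠ some o := by
    rintro rfl
    exact H.seq (by rw [hraw]; rfl)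
  -- the contents of the two nodes that are written, one after the other
  set x₀ : Node n M A B := newNode (some (m, a)) with hx₀
  set x₁ : Node n M A B := { x₀ with hist := some g.recorder } with hx₁
  set x₂ : Node n M A B := { x₁ with lin := some L } with hx₂
  set y₀ := g.node last with hy₀
  set y₁ : Node n M A B := { y₀ with decideNext := some (some o) } with hy₁
  have hseq₀ : ∀ r, (g.node r).seq ≠ 0 →
      ∀ hd, ((runMem g i o last x₀ y₀ hd).node r).seq = (g.node r).seq := by
    intro r hr hd
    by_cases h1 : r = some o
    · subst h1; exact (hr (by rw [hraw]; rfl)).elim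
    · by_cases h2 : r = last
      · rw [h2, runMem_node_last hne]
      · rw [runMem_node_ne h1 h2]
  have hseq_le : ∀ k hd, ((runMem g i o last x₀ y₀ hd).node (g.head k)).seq ≤ y₀.seq := by
    intro k hd
    by_cases h1 : (g.node (g.head k)).seq = 0
    · by_cases h2 : g.head k = some o
      · rw [h2, runMem_node_own]; exact Nat.zero_le _
      · by_cases h3 : g.head k = last
        · rw [h3, runMem_node_last hne]
        · rw [runMem_node_ne h2 h3, h1]; exact Nat.zero_le _
    · rw [hseq₀ _ h1]; exact H.head_le k
  obtain ⟨j, hj⟩ := H.head_eq i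
  have s1 : Step Spec i (.announceNode m a o, g)
      (.maxHead m o, runMem g i o last x₀ y₀ (g.head i)) := by
    convert Step.announceNode g m a o using 2
    simp only [setNode, runMem, Shared.mk.injEq, true_and, and_true, Function.update_eq_self]
    funext r
    by_cases h1 : r = some o
    · simp [h1, hx₀]
    · by_cases h2 : r = last <;> simp [h1, h2, hy₀]
      simp [hne]
  have s2 : Step Spec i (.maxHead m o, runMem g i o last x₀ y₀ (g.head i))
      (.loopTest m o, runMem g i o last x₀ y₀ last) := by
    have hhead : (runMem g i o last x₀ y₀ (g.head i)).head = g.head := Function.update_eq_self i _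
    have := Step.maxHead (Spec := Spec) (i := i) (runMem g i o last x₀ y₀ (g.head i)) m o j ?_
    · rwa [hhead, hj, setHead_runMem] at this
    · intro k
      rw [hhead, hj, runMem_node_last hne]
      exact hseq_le k _
  have hann : ∀ {x y hd}, (runMem g i o last x y hd).announce i = some o := by
    intro x y hd; simp [runMem]
  have s3 : Step Spec i (.loopTest m o, runMem g i o last x₀ y₀ last)
      (.readBefore m o, runMem g i o last x₀ y₀ last) :=
    .loopEnter _ m o (by rw [hann, runMem_node_own]; rfl)
  have s4 : Step Spec i (.readBefore m o, runMem g i o last x₀ y₀ last)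
      (.readHelp m o last, runMem g i o last x₀ y₀ last) := by
    have := Step.readBefore (Spec := Spec) (i := i) (runMem g i o last x₀ y₀ last) m o
    rwa [show (runMem g i o last x₀ y₀ last).head i = last by simp [runMem]] at this
  have s5 : Run Spec i (.readHelp m o last, runMem g i o last x₀ y₀ last)
      (.decide m o last (some o), runMem g i o last x₀ y₀ last) := by
    have t1 := Step.readHelp (Spec := Spec) (i := i) (runMem g i o last x₀ y₀ last) m o last
    generalize modIndex i _ = k at t1
    by_cases hk : k = i
    · rw [hk, hann] at t1
      exact .tail (.tail (.single t1) (.testHelpZero _ m o last (some o)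
        (by rw [runMem_node_own]; rfl))) (.preferHelp _ m o last (some o))
    · refine .tail (.tail (.single t1) (.testHelpNonzero _ m o last _ ?_)) ?_
      · have : (runMem g i o last x₀ y₀ last).announce k = g.announce k := by simp [runMem, hk]
        rw [this, hseq₀ _ (H.announce k)]
        exact H.announce k
      · have := Step.preferOwn (Spec := Spec) (i := i) (runMem g i o last x₀ y₀ last) m o last
        rwa [hann] at this
  have s6 : Step Spec i (.decide m o last (some o), runMem g i o last x₀ y₀ last)
      (.readHist m o last (some o), runMem g i o last x₀ y₁ last) := by
    have := Step.decide (Spec := Spec) (i := i) (runMem g i o last x₀ y₀ last) m o last (some o)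
    rwa [runMem_node_last hne, setNode_runMem_last hne, H.decideNext] at this
  have s7 : Step Spec i (.readHist m o last (some o), runMem g i o last x₀ y₁ last)
      (.casHist m o last (some o) g.recorder, runMem g i o last x₀ y₁ last) := .readHist _ m o _ _
  have s8 : Step Spec i (.casHist m o last (some o) g.recorder, runMem g i o last x₀ y₁ last)
      (.genLin m o last (some o), runMem g i o last x₁ y₁ last) := by
    have := Step.casHist (Spec := Spec) (i := i) (runMem g i o last x₀ y₁ last) m o last (some o)
      g.recorder
    rwa [runMem_node_own, setNode_runMem_own] at this
  have s9 : Step Spec i (.genLin m o last (some o), runMem g i o last x₁ y₁ last)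
      (.casLin m o last (some o) L, runMem g i o last x₁ y₁ last) := by
    refine .genLin _ m o _ _ L ⟨⟨g.recorder, by rw [runMem_node_own], hL⟩, ⟨o, b, rfl, hb⟩,
      fun o' ho' _ => ?_⟩
    have hnext : ∀ r, ((runMem g i o last x₁ y₁ last).node r).next = (g.node r).next := by
      intro r
      by_cases h1 : r = some o
      · rw [h1, runMem_node_own, hraw]; rfl
      · by_cases h2 : r = last
        · rw [h2, runMem_node_last hne]
        · rw [runMem_node_ne h1 h2]
    simp only [Reaches, hnext] at ho'
    obtain ⟨l₀, b', h1, h2, h3⟩ := hvals o' ho'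
    refine ⟨l₀, b', ?_, h2, h3⟩
    have hne' : some o' ≠ some o := by
      intro h'
      rw [h', hraw] at h1
      simp [newNode] at h1
    by_cases h4 : some o' = last
    · rw [h4] at h1 ⊢
      rw [runMem_node_last hne]
      exact h1
    · rwa [runMem_node_ne hne' h4]
  have s10 : Step Spec i (.casLin m o last (some o) L, runMem g i o last x₁ y₁ last)
      (.setNext m o last (some o), runMem g i o last x₂ y₁ last) := by
    have := Step.casLin (Spec := Spec) (i := i) (runMem g i o last x₁ y₁ last) m o last (some o) L
    rwa [runMem_node_own, setNode_runMem_own] at this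
  have s11 : Step Spec i (.setNext m o last (some o), runMem g i o last x₂ y₁ last)
      (.setSeq m o last (some o), runMem g i o last x₂ (linkNode g last o) last) := by
    have := Step.setNext (Spec := Spec) (i := i) (runMem g i o last x₂ y₁ last) m o last (some o)
    rwa [runMem_node_last hne, setNode_runMem_last hne] at this
  have s12 : Step Spec i (.setSeq m o last (some o), runMem g i o last x₂ (linkNode g last o) last)
      (.setHead m o (some o),
        runMem g i o last (ownNode g last m a L) (linkNode g last o) last) := by
    have := Step.setSeq (Spec := Spec) (i := i) (runMem g i o last x₂ (linkNode g last o) last)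
      m o last (some o)
    rwa [runMem_node_last hne, runMem_node_own, setNode_runMem_own] at this
  have s13 := Step.setHead (Spec := Spec) (i := i)
    (runMem g i o last (ownNode g last m a L) (linkNode g last o) last) m o (some o)
  rw [setHead_runMem] at s13
  have s14 := Step.loopExit (Spec := Spec) (i := i)
    (runMem g i o last (ownNode g last m a L) (linkNode g last o) (some o)) m o
    (by rw [hann, runMem_node_own]; exact Nat.succ_ne_zero _)
  have s15 := Step.setHeadOwn (Spec := Spec) (i := i)
    (runMem g i o last (ownNode g last m a L) (linkNode g last o) (some o)) m o
  rw [hann, setHead_runMem] at s15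
  have s16 := Step.getRetValue (Spec := Spec) (i := i)
    (runMem g i o last (ownNode g last m a L) (linkNode g last o) (some o)) m o L b hreach
    (by rw [runMem_node_own]; rfl) hb
  have s17 := Step.storeReturn (Spec := Spec) (i := i)
    (runMem g i o last (ownNode g last m a L) (linkNode g last o) (some o)) m o b
  have r4 : Run Spec i (.announceNode m a o, g)
      (.readHelp m o last, runMem g i o last x₀ y₀ last) :=
    (((Relation.ReflTransGen.single s1).tail s2).tail s3).tail s4
  exact (((((((((((((r4.trans s5).tail s6).tail s7).tail s8).tail s9).tail s10).tail s11).tail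
    s12).tail s13).tail s14).tail s15).tail s16).tail s17)

/-- The return of an operation: it is announced, appended to the list, and returns. -/
lemma Quiet.ret (H : Quiet h g φ π last) {i : Fin n} {m : M} (hi : φ i = some m) {b : B}
    (hlin : Linearizable Spec (h ++ [.ret i m b ()])) :
    ∃ g' π' l last', (USpec Spec n).sem.Path (config Spec g π) l (config Spec g' π') ∧
      history l = [.ret i m b ()] ∧
      Quiet (h ++ [.ret i m b ()]) g' (Function.update φ i none) π' last' := by
  have hw := H.waiting i
  rw [hi] at hw
  obtain ⟨a, o, q, hπ, hq, ht⟩ := hw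
  have ho : (g.node (some o)).inv = none := (H.oid.fresh i m _ o hπ rfl).2
  have hraw := H.raw o ho
  have hne : last ≠ some o := by
    rintro rfl
    exact H.seq (by rw [hraw]; rfl)
  have hpair : Paired (sub i (g.recorder ++ [.ret i m b o])) := by
    rw [sub_append, ht]
    simpa [sub_cons, Event.pid] using hq.append (.cons i m a b o .nil)
  have hother : ∀ j, j ≠ i → sub j (g.recorder ++ [.ret i m b o]) = sub j g.recorder := by
    intro j hj
    simp [sub_cons, Event.pid, Ne.symm hj]
  have hhist : IsHistory (g.recorder ++ [.ret i m b o]) := by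
    intro j
    by_cases hj : j = i
    · subst hj; exact hpair.completion.isSequential
    · rw [hother j hj]; exact H.isHistory j
  have huntag : untag (g.recorder ++ [.ret i m b o]) = h ++ [.ret i m b ()] := by
    rw [untag_append, H.recorder]; rfl
  -- all operations that have returned keep their return values in this linearization
  obtain ⟨L, hL⟩ := Linearizable.of_untag hhist (huntag ▸ hlin)
  have hvals : ∀ o' : ℕ, Reaches g none (some o') →
      ∃ l₀ b, (g.node (some o')).lin = some l₀ ∧ HasRet l₀ o' b ∧ HasRet L o' b := by
    intro o' ho'
    obtain ⟨l, b', i', m', h1, h2, h3⟩ := H.vals o' ho'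
    exact ⟨l, b', h1, h2, i', m', hL.ret_mem (List.mem_append_left _ h3)⟩
  have hb : HasRet L o b := ⟨i, m, hL.ret_mem (by simp)⟩
  set g₁ := runMem g i o last (ownNode g last m a L) (linkNode g last o) (some o) with hg₁
  have hmono : ∀ r r', Reaches g r r' → Reaches g₁ r r' := by
    intro r r' hr
    refine Relation.ReflTransGen.mono (fun x y hxy => ?_) r r' hr
    have h1 : x ≠ some o := by
      rintro rfl
      rw [hraw] at hxy
      simp [newNode] at hxy
    have h2 : x ≠ last := by
      rintro rfl
      simp [H.next] at hxy
    rwa [hg₁, runMem_node_ne h1 h2]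
  have hreach : Reaches g₁ none (some o) :=
    .tail (hmono _ _ H.reaches) (by rw [hg₁, runMem_node_last hne]; rfl)
  have hreach_inv : ∀ r, Reaches g₁ none r → r = some o ∨ Reaches g none r := by
    intro r hr
    induction hr with
    | refl => exact .inr .refl
    | @tail x y _ hxy ih =>
      by_cases h1 : x = some o
      · rw [h1, hg₁, runMem_node_own] at hxy
        simp [ownNode] at hxy
      by_cases h2 : x = last
      · rw [h2, hg₁, runMem_node_last hne] at hxy
        left
        simpa [linkNode] using hxy.symm
      · rw [hg₁, runMem_node_ne h1 h2] at hxy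
        exact .inr ((ih.resolve_left h1).tail hxy)
  have hrun := H.run ho (i := i) (m := m) (a := a) (hL.of_append_ret rfl) hb hvals hreach
  have hoid := H.oid.run hπ hrun
  obtain ⟨l, hl1, hl2⟩ := hrun.exists_path hπ
  have hseq : ∀ r, (g.node r).seq ≠ 0 → (g₁.node r).seq ≠ 0 := by
    intro r hr
    by_cases h1 : r = some o
    · rw [h1, hg₁, runMem_node_own]; exact Nat.succ_ne_zero _
    by_cases h2 : r = last
    · rw [h2, hg₁, runMem_node_last hne]; exact H.seq
    · rwa [hg₁, runMem_node_ne h1 h2]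
  have hown : g₁.node (some o) = ownNode g last m a L := runMem_node_own
  refine ⟨{ g₁ with recorder := g.recorder ++ [.ret i m b o] }, Function.update π i none,
    l ++ [.event (.ret i m b ())], some o, hl1.append (.cons ?_ (.nil _)), ?_, ⟨?_, huntag, ?_,
    H.finite, ?_, ?_, hreach, ?_, ?_, ?_, ?_, ?_, ?_⟩⟩
  · have := config_ret (Spec := Spec) (g := { g₁ with recorder := g.recorder ++ [.ret i m b o] })
      (π := Function.update π i (some (m, .done b))) (i := i) (Function.update_self ..)
    rwa [Function.update_idem] at this
  · rw [history_append, hl2]; rfl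
  · intro j
    by_cases hj : j = i
    · subst hj
      rw [Function.update_self, Function.update_self]
      exact ⟨rfl, hpair⟩
    · rw [Function.update_of_ne hj, Function.update_of_ne hj]
      simp only [hother j hj]
      exact H.waiting j
  · have := hoid.update_of_not_fresh (i := i) (x := none) (by simp) rfl (fun _ => rfl) rfl
    rwa [Function.update_idem] at this
  · intro o' h'
    by_cases h1 : o' = o
    · subst h1
      rw [hown] at h'
      simp [ownNode] at h'
    · have h1' : some o' ≠ some o := by simpa using h1
      by_cases h2 : some o' = last
      · change (g₁.node (some o')).inv = none at h'
        rw [h2, hg₁, runMem_node_last hne] at h'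
        change (g.node last).inv = none at h'
        rw [← h2] at h'
        have := H.raw o' h'
        rw [h2] at this
        exact (H.seq (by rw [this]; rfl)).elim
      · change (g₁.node (some o')).inv = none at h'
        change g₁.node (some o') = newNode none
        rw [hg₁, runMem_node_ne h1' h2] at h' ⊢
        exact H.raw o' h'
  · intro k
    by_cases hk : k = i
    · subst hk
      change (g₁.node (Function.update g.announce k (some o) k)).seq ≠ 0
      rw [Function.update_self, hown]
      exact Nat.succ_ne_zero _
    · change (g₁.node (Function.update g.announce i (some o) k)).seq ≠ 0
      rw [Function.update_of_ne hk]
      exact hseq _ (H.announce k)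
  · simp only [hown]; rfl
  · simp only [hown]; rfl
  · simp only [hown]; exact Nat.succ_ne_zero _
  · intro k
    simp only [hown]
    change _ ≤ (g.node last).seq + 1
    by_cases hk : k = i
    · subst hk
      change (g₁.node (Function.update g.head k (some o) k)).seq ≤ _
      rw [Function.update_self, hown]
      exact le_rfl
    · change (g₁.node (Function.update g.head i (some o) k)).seq ≤ _
      rw [Function.update_of_ne hk]
      by_cases h1 : g.head k = some o
      · rw [h1, hown]; exact le_rfl
      by_cases h2 : g.head k = last
      · rw [h2, hg₁, runMem_node_last hne]; exact Nat.le_succ _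
      · rw [hg₁, runMem_node_ne h1 h2]; exact (H.head_le k).trans (Nat.le_succ _)
  · exact fun _ => ⟨i, Function.update_self ..⟩
  · intro o' ho'
    rcases hreach_inv _ ho' with h' | h'
    · obtain rfl : o' = o := by simpa using h'
      exact ⟨L, b, i, m, by simp only [hown]; rfl, hb, by simp⟩
    · obtain ⟨l₀, b', i', m', h1, h2, h3⟩ := H.vals o' h'
      refine ⟨l₀, b', i', m', ?_, h2, List.mem_append_left _ h3⟩
      have hne' : some o' ≠ some o := by
        intro h''
        rw [h'', hraw] at h1
        simp [newNode] at h1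
      change (g₁.node (some o')).lin = some l₀
      by_cases h4 : some o' = last
      · rw [h4] at h1 ⊢
        rw [hg₁, runMem_node_last hne]
        exact h1
      · rwa [hg₁, runMem_node_ne hne' h4]

end Quiet

end Universal

/-! ### The equivalence -/

theorem ConcurrentObject.IsLinearizable.forwardSimulated {n : ℕ} {M A B : Type*}
    {Spec : Set (List (Operation M A B))} {O : ConcurrentObject n M A B}
    (H : O.IsLinearizable Spec) : ForwardSimulated O.sem (USpec Spec n).sem := by
  refine ⟨fun c₁ c₂ => ∃ e last, O.sem.Path O.sem.start e c₁ ∧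
    Universal.Quiet (history e) c₂.shared (fun i => (c₁.proc i).map Prod.fst) c₂.proc last,
    ⟨[], none, .nil _, Universal.quiet_init⟩, ?_⟩
  rintro c₁ c₂ ⟨e, last, hpath, hq⟩ α c₁' ht
  have hpath' := hpath.append (.cons ht (.nil _))
  have hφ : ∀ (i : Fin n) (x : Option (M × O.Local)),
      (fun j => (Function.update c₁.proc i x j).map Prod.fst) =
        Function.update (fun j => (c₁.proc j).map Prod.fst) i (x.map Prod.fst) := by
    intro i x
    funext j
    by_cases hj : j = i
    · subst hj; simp
    · simp [hj]
  have hlin := H _ ⟨_, hpath'⟩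
  rw [history_append] at hlin
  cases ht with
  | call i m a hi =>
    obtain ⟨g', π', l, h1, h2, h3⟩ := hq.call (Spec := Spec) (i := i) (by simp [hi]) m a
    refine ⟨l, Universal.config Spec g' π', h1, h2, _, last, hpath', ?_⟩
    rw [history_append]
    dsimp only
    rw [hφ]
    exact h3
  | step i m p p' cmd g' hi hs =>
    refine ⟨[], c₂, .nil _, rfl, _, last, hpath', ?_⟩
    rw [history_append]
    dsimp only
    rw [hφ, Function.update_eq_self_iff.2 (by simp [hi])]
    change Universal.Quiet (history e ++ []) _ _ _ _
    rwa [List.append_nil]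
  | ret i m p b hi hb =>
    obtain ⟨g', π', l, last', h1, h2, h3⟩ := hq.ret (i := i) (m := m) (by simp [hi]) hlin
    refine ⟨l, Universal.config Spec g' π', h1, h2, _, last', hpath', ?_⟩
    rw [history_append]
    dsimp only
    rw [hφ]
    exact h3

end Linz

theorem theorem1 {M : Type*} {A : Type*} {B : Type*}
    (Spec : Set (List (Linz.Operation M A B)))
    (S : Linz.LTS (Linz.Operation M A B)) (hS : S.traces = Spec)
    (hdet : S.Deterministic) (hnb : S.NonBlocking)
    (n : ℕ) (O : Linz.ConcurrentObject n M A B) :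
    O.IsLinearizable Spec ↔ Linz.ForwardSimulated O.sem (Linz.USpec Spec n).sem := by
  refine ⟨fun H => H.forwardSimulated, fun H e he => ?_⟩
  obtain ⟨e', he', heq⟩ := H.exists_path he
  rw [← heq]
  exact Linz.USpec_isLinearizable (hS ▸ ⟨_, .nil _⟩) n e' he'
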